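/- **Definitions.** An *Ising model* $\mathcal M=(N,E)$ consists of a set $N\subseteq\mathbb N$ of system sizes and, for each $n\in N$, a set of edges $E_n\subseteq\{(i,j): 1\le i<j\le n\}$ such that every vertex $i\in\{1,\dots,n\}$ lies on some edge. For $I\subseteq E_n$ and $s=s_1\dots s_n\in\{0,1\}^n$ put $H|_I(s)=\sum_{(i,j)\in I}h(s_i,s_j)$, where $h(a,b)=-1$ if $a=b$ and $h(a,b)=+1$ otherwise, and $H(s)=H|_{E_n}(s)$. For $z\in\mathbb Z$ let $u(z)$ be its unary encoding: $+^{z}$ if $z\ge 0$, and $-^{-z}$ if $z<0$. The *language of $\mathcal M$* is $\mathsf L_{\mathcal M}=\{s_1\dots s_n\bullet u(H(s_1\dots s_n)) : n\in N,\ s_i\in\{0,1\}\}$ over the alphabet $\{0,1,\bullet,+,-\}$. The *well-formed inputs* are the words $s_1\dots s_n\bullet u(k)$ with $n\in N$, $s_i\in\{0,1\}$, $k\in\mathbb Z$. An automaton *decides* a language if it accepts exactly the words of that language. $\mathsf L_{\mathcal M}$ is *constructive context free* if it is decided by a (nondeterministic) pushdown automaton $P$ that has two distinct stack symbols for $+$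 and $-$, different from the bottom symbol, a set $S$ of marked states and a set $C$ of comparison states, such that: - For every $n\in N$ there is a unique ordered partition $E_n=I_1\sqcup\dots\sqcup I_r$ into nonempty sets such that the following holds on all inputs $s\bullet u(k)$ with $s\in\{0,1\}^n$, $k\in\mathbb Z$. Some computation path reaches a state in $C$, and no path accepts before it has done so. Every path that reaches $C$ passes, before it first does so, through exactly $r$ configurations with state in $S$. In the $m$-th of these the stack holds $u(\sum_{l<m}H|_{I_l}(s))$ above the bottom symbol, and the values $s_i$ of all spins $i$ that occur in $I_m$ are stored in the state of $P$, i.e. they are determined by this state by means of a function that depends only on $P$, $n$ and $m$. When $C$ is first reached, the stack holds $u(H(s))$ above the bottom symbol and exactly $u(k)$ is still unread. - For every state in $C$ and all $z,k\in\mathbb Z$: started in this state with stack content $u(z)$ above the bottom symbol and unread input $u(k)$, $P$ accepts if and only if $z=k$. $\mathsf L_{\mathcal M}$ is *constructive context sensitive* if it is decided by a (nondeterministic, multitape) linear bounded automaton $A$ (every tape has as many usable cells as the input has letters, between two endmarkers) that has a designated energy tape $T_e$ different from the input tape, two distinct tape symbols for binary digits, different from the blank and the endmarkers, and a set $C$ of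 comparison states, such that on every well-formed input $s\bullet u(k)$: - before a state in $C$ is reached, $A$ neither scans an input cell to the right of $\bullet$ nor accepts, and some computation path reaches $C$; - whenever $C$ is first reached on a path, $T_e$ holds $H(s)$ in binary (a sign bit followed by the binary digits of $|H(s)|$), and from there on $A$ compares the content of $T_e$ with the input energy: for every $z\in\mathbb Z$ whose encoding fits on the tape, if the content of $T_e$ is replaced by the encoding of $z$, then $A$ accepts from this configuration if and only if $z=k$. **Proposition (refined Chomsky hierarchy).** Let $\mathcal M$ be an Ising model and $\mathsf L_{\mathcal M}$ its language. 1. If $\mathsf L_{\mathcal M}$ is regular, then it is constructive context free. 2. If $\mathsf L_{\mathcal M}$ is context free, then it is constructive context sensitive. -/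

import Mathlib

/-! ### Ising models and their languages -/

/-- The five-letter alphabet `0, 1, •, +, -`. -/
inductive IsingSymbol where
  | zero | one | sep | plus | minus
  deriving DecidableEq

/-- The word `σ^|z|`, where `σ` is `p` for `z > 0` and `m` for `z < 0` (unary encoding of `z`). -/
def unary {β : Type} (p m : β) (z : ℤ) : List β :=
  if 0 ≤ z then List.replicate z.natAbs p else List.replicate z.natAbs m

/-- The unary encoding of an energy as an input word. -/
def energyWord (z : ℤ) : List IsingSymbol := unary IsingSymbol.plus IsingSymbol.minus z

/-- The letters of a spin configuration. -/
def spinSymbol : Bool → IsingSymbol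
  | false => IsingSymbol.zero
  | true => IsingSymbol.one

/-- The word `s₁ … sₙ • u(z)`. -/
def spinEnergyWord {n : ℕ} (s : Fin n → Bool) (z : ℤ) : List IsingSymbol :=
  List.ofFn (fun i => spinSymbol (s i)) ++ IsingSymbol.sep :: energyWord z

/-- An Ising model: a set of system sizes and, for each size `n`, an ordered interaction graph on
`n` vertices without isolated vertices. The value of `edges n` is irrelevant if `n ∉ sizes`. -/
structure IsingModel where
  sizes : Set ℕ
  edges : (n : ℕ) → Finset (Fin n × Fin n)
  edges_lt : ∀ n ∈ sizes, ∀ e ∈ edges n, e.1 < e.2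
  no_isolated : ∀ n ∈ sizes, ∀ i : Fin n, ∃ e ∈ edges n, e.1 = i ∨ e.2 = i

/-- The energy `∑ h(sᵢ, sⱼ)` of the edges in `I`: equal spins contribute `-1`, different
ones `+1`. -/
def edgeEnergy {n : ℕ} (I : Finset (Fin n × Fin n)) (s : Fin n → Bool) : ℤ :=
  ∑ e ∈ I, if s e.1 = s e.2 then -1 else 1

/-- The vertices that occur in an edge of `I`. -/
def edgeSupport {n : ℕ} (I : Finset (Fin n × Fin n)) : Set (Fin n) :=
  {i | ∃ j, (i, j) ∈ I ∨ (j, i) ∈ I}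

namespace IsingModel

/-- The Hamiltonian on configurations of `n` spins. -/
def hamiltonian (M : IsingModel) {n : ℕ} (s : Fin n → Bool) : ℤ := edgeEnergy (M.edges n) s

/-- The language of an Ising model: the function graph of its Hamiltonian, with the energy written
in unary. -/
def language (M : IsingModel) : Language IsingSymbol :=
  {w | ∃ n ∈ M.sizes, ∃ s : Fin n → Bool, w = spinEnergyWord s (M.hamiltonian s)}

end IsingModel

/-! ### Pushdown automata -/

/-- A nondeterministic pushdown automaton over the input alphabet `α`. The tuple
`(q, x, t, q', v) ∈ trans` means: in state `q`, reading `x` (`none`: reading nothing) and popping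
`t`, go to `q'` and push `v`; the first letter of `v` becomes the top of the stack. -/
structure PushdownAutomaton (α : Type) where
  State : Type
  Stack : Type
  [finState : Finite State]
  [finStack : Finite Stack]
  trans : Set (State × Option α × Stack × State × List Stack)
  finite_trans : trans.Finite
  start : State
  bottom : Stack
  accept : Set State

namespace PushdownAutomaton

variable {α : Type}

/-- A configuration: state, unread input, stack (top first). -/
structure Config (P : PushdownAutomaton α) where
  state : P.State
  input : List α
  stack : List P.Stack

/-- One step of the computation. -/
inductive Step (P : PushdownAutomaton α) : P.Config → P.Config → Prop
  | read {q q' : P.State} {x : α} {t : P.Stack} {v : List P.Stack} (w : List α)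
      (γ : List P.Stack) (h : (q, some x, t, q', v) ∈ P.trans) :
      Step P ⟨q, x :: w, t :: γ⟩ ⟨q', w, v ++ γ⟩
  | eps {q q' : P.State} {t : P.Stack} {v : List P.Stack} (w : List α)
      (γ : List P.Stack) (h : (q, none, t, q', v) ∈ P.trans) :
      Step P ⟨q, w, t :: γ⟩ ⟨q', w, v ++ γ⟩

/-- The initial configuration on input `w`. -/
def init (P : PushdownAutomaton α) (w : List α) : P.Config := ⟨P.start, w, [P.bottom]⟩

/-- The input has been processed and the state is an accept state. -/
def Accepting (P : PushdownAutomaton α) (c : P.Config) : Prop := c.input = [] ∧ c.state ∈ P.accept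

/-- Some computation path from `c` accepts. -/
def AcceptsFrom (P : PushdownAutomaton α) (c : P.Config) : Prop :=
  ∃ d, Relation.ReflTransGen P.Step c d ∧ P.Accepting d

/-- The language decided by a pushdown automaton; every other word is rejected. -/
def language (P : PushdownAutomaton α) : Language α := {w | P.AcceptsFrom (P.init w)}

/-- `P.Accumulates S C c l d`: there is a computation from `c` to `d` whose only configuration with
state in `C` is its last one, `d`, and `l` lists the configurations before `d` with state in `S`
in the order of their occurrence. -/
inductive Accumulates (P : PushdownAutomaton α) (S C : Set P.State) :
    P.Config → List P.Config → P.Config → Prop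
  | done {c : P.Config} (hC : c.state ∈ C) : Accumulates P S C c [] c
  | pass {c c' d : P.Config} {l : List P.Config} (hC : c.state ∉ C) (hS : c.state ∉ S)
      (h : P.Step c c') (h' : Accumulates P S C c' l d) : Accumulates P S C c l d
  | mark {c c' d : P.Config} {l : List P.Config} (hC : c.state ∉ C) (hS : c.state ∈ S)
      (h : P.Step c c') (h' : Accumulates P S C c' l d) : Accumulates P S C c (c :: l) d

/-- The stack that holds the unary encoding of `z` above the bottom symbol. -/
def energyStack (P : PushdownAutomaton α) (p m : P.Stack) (z : ℤ) : List P.Stack :=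
  unary p m z ++ [P.bottom]

end PushdownAutomaton

/-- `I₁, …, I_r` is a partition of the edge set `E` (into nonempty, pairwise disjoint sets). -/
def IsEdgePartition {n : ℕ} (E : Finset (Fin n × Fin n)) (I : List (Finset (Fin n × Fin n))) :
    Prop :=
  (∀ J ∈ I, J.Nonempty) ∧ I.Pairwise Disjoint ∧ ∀ e, e ∈ E ↔ ∃ J ∈ I, e ∈ J

/-- On all inputs `s₁ … sₙ • u(k)`, the first phase of `P` (up to the first comparison state, a
state in `C`) is an iteration over `I₁, …, I_r`. The configurations with state in `S` mark its
steps. In the `m`-th of them, the stack holds the energy of the earlier parts, and the states of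
the spins that interact according to the `m`-th part are stored in the state of `P`: they can be
read off from it by a function `stored m` that does not depend on the spin configuration. When a
comparison state is entered, the energy of all parts has been accumulated on the stack, and the
input energy has not been read yet. Some computation path gets there, and no computation path
accepts without getting there. -/
def IteratesOver (P : PushdownAutomaton IsingSymbol) (p m : P.Stack) (S C : Set P.State) {n : ℕ}
    (I : List (Finset (Fin n × Fin n))) : Prop :=
  ∃ stored : ℕ → P.State → Fin n → Bool, ∀ (s : Fin n → Bool) (k : ℤ),
    (∃ l d, P.Accumulates S C (P.init (spinEnergyWord s k)) l d) ∧
    (∀ l d, P.Accumulates S C (P.init (spinEnergyWord s k)) l d →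
      l.length = I.length ∧
      (∀ (j : ℕ) (c : P.Config) (J : Finset (Fin n × Fin n)), l[j]? = some c → I[j]? = some J →
        c.stack = P.energyStack p m ((I.take j).map (fun J' => edgeEnergy J' s)).sum ∧
        ∀ i ∈ edgeSupport J, stored j c.state i = s i) ∧
      d.input = energyWord k ∧
      d.stack = P.energyStack p m (I.map (fun J' => edgeEnergy J' s)).sum) ∧
    (∀ d, Relation.ReflTransGen (fun c c' => c.state ∉ C ∧ P.Step c c')
        (P.init (spinEnergyWord s k)) d → d.state ∉ C → ¬ P.Accepting d)

/-- A constructive pushdown automaton for the Ising model `M`: it decides the language of `M`;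
for each system size there is a unique partition of the edges over which it iterates to accumulate
the energy in unary on its stack (with stack symbols `p`, `m` for `+`, `-`); afterwards, in its
comparison states `C`, it compares the stack content with the input energy and accepts if and only
if they are equal. -/
def PushdownAutomaton.IsConstructiveFor (P : PushdownAutomaton IsingSymbol) (M : IsingModel) :
    Prop :=
  P.language = M.language ∧
  ∃ (p m : P.Stack) (S C : Set P.State), p ≠ m ∧ p ≠ P.bottom ∧ m ≠ P.bottom ∧
    (∀ n ∈ M.sizes, ∃! I : List (Finset (Fin n × Fin n)),
      IsEdgePartition (M.edges n) I ∧ IteratesOver P p m S C I) ∧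
    (∀ q ∈ C, ∀ z k : ℤ, P.AcceptsFrom ⟨q, energyWord k, P.energyStack p m z⟩ ↔ z = k)

/-! ### Linear bounded automata -/

/-- Head moves: left, none, right. -/
inductive HeadMove where
  | left | stay | right

/-- The new head position. -/
def HeadMove.apply : HeadMove → ℕ → ℕ
  | .left, i => i - 1
  | .stay, i => i
  | .right, i => i + 1

/-- A nondeterministic linear bounded automaton over the input alphabet `α`, with finitely many
tapes, one of which initially holds the input. The endmarkers `endL`, `endR` are never overwritten,
and no head moves past them. -/
structure LinearBoundedAutomaton (α : Type) where
  State : Type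
  Symbol : Type
  Tape : Type
  [finState : Finite State]
  [finSymbol : Finite Symbol]
  [finTape : Finite Tape]
  letter : α → Symbol
  letter_injective : Function.Injective letter
  blank : Symbol
  endL : Symbol
  endR : Symbol
  blank_ne_endL : blank ≠ endL
  blank_ne_endR : blank ≠ endR
  endL_ne_endR : endL ≠ endR
  letter_ne_blank : ∀ a, letter a ≠ blank
  letter_ne_endL : ∀ a, letter a ≠ endL
  letter_ne_endR : ∀ a, letter a ≠ endR
  inputTape : Tape
  /-- `trans q a q' b d`: in state `q`, reading `a i` on each tape `i`, the automaton may go to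
  `q'`, write `b i` and move the head of tape `i` according to `d i`. -/
  trans : State → (Tape → Symbol) → State → (Tape → Symbol) → (Tape → HeadMove) → Prop
  trans_endL : ∀ q a q' b d, trans q a q' b d →
    ∀ i, a i = endL → b i = endL ∧ d i ≠ HeadMove.left
  trans_endR : ∀ q a q' b d, trans q a q' b d →
    ∀ i, a i = endR → b i = endR ∧ d i ≠ HeadMove.right
  start : State
  accept : Set State

namespace LinearBoundedAutomaton

variable {α : Type}

/-- A configuration: state, tape contents, head positions. On an input of length `N`, the
endmarkers are in cells `0` and `N + 1` of each tape, and the cells `1, …, N` can be used. -/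
structure Config (A : LinearBoundedAutomaton α) where
  state : A.State
  tape : A.Tape → ℕ → A.Symbol
  head : A.Tape → ℕ

/-- The content of a tape with `N` usable cells that holds the word `w` (of length at most `N`),
followed by blanks. -/
def tapeOf (A : LinearBoundedAutomaton α) (N : ℕ) (w : List A.Symbol) : ℕ → A.Symbol
  | 0 => A.endL
  | i + 1 => if i < N then w.getD i A.blank else if i = N then A.endR else A.blank

open Classical in
/-- The initial configuration on input `w`; all heads are on cell `1`. -/
noncomputable def init (A : LinearBoundedAutomaton α) (w : List α) : A.Config where
  state := A.start
  tape i := A.tapeOf w.length (if i = A.inputTape then w.map A.letter else [])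
  head _ := 1

open Classical in
/-- One step of the computation. -/
def Step (A : LinearBoundedAutomaton α) (c c' : A.Config) : Prop :=
  ∃ b d, A.trans c.state (fun i => c.tape i (c.head i)) c'.state b d ∧
    (∀ i, c'.tape i = Function.update (c.tape i) (c.head i) (b i)) ∧
    (∀ i, c'.head i = (d i).apply (c.head i))

/-- The automaton has halted in an accept state. -/
def Accepting (A : LinearBoundedAutomaton α) (c : A.Config) : Prop :=
  c.state ∈ A.accept ∧ ∀ d, ¬ A.Step c d

/-- Some computation path from `c` halts in an accept state. -/
def AcceptsFrom (A : LinearBoundedAutomaton α) (c : A.Config) : Prop :=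
  ∃ d, Relation.ReflTransGen A.Step c d ∧ A.Accepting d

/-- The language decided by a linear bounded automaton; every other word is rejected. -/
def language (A : LinearBoundedAutomaton α) : Language α := {w | A.AcceptsFrom (A.init w)}

end LinearBoundedAutomaton

/-- The binary encoding of an integer: a sign bit (`true` for negative numbers) and the binary
digits of the absolute value, least significant digit first. -/
def binary (z : ℤ) : List Bool := decide (z < 0) :: z.natAbs.bits

open Classical in
/-- A constructive linear bounded automaton for the Ising model `M`: it decides the language of
`M` and has a designated energy tape `T`, symbols `bit` for binary digits and a set `C` of
comparison states such that on all inputs `s₁ … sₙ • u(k)` with `n` a system size of `M`: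
* before it enters a comparison state, it neither visits the cells of the input energy nor accepts;
* some computation path enters a comparison state;
* whenever a comparison state is entered for the first time, the energy tape holds
  the energy of `s₁ … sₙ` in binary, and from there on the automaton compares the content of the
  energy tape with the input energy: for every content `z` of the energy tape, it accepts if and
  only if `z` is the input energy. -/
def LinearBoundedAutomaton.IsConstructiveFor (A : LinearBoundedAutomaton IsingSymbol)
    (M : IsingModel) : Prop :=
  A.language = M.language ∧
  ∃ (T : A.Tape) (bit : Bool → A.Symbol) (C : Set A.State),
    T ≠ A.inputTape ∧ Function.Injective bit ∧
    (∀ b, bit b ≠ A.blank ∧ bit b ≠ A.endL ∧ bit b ≠ A.endR) ∧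
    ∀ n ∈ M.sizes, ∀ (s : Fin n → Bool) (k : ℤ),
      (∀ c, Relation.ReflTransGen (fun c c' => c.state ∉ C ∧ A.Step c c')
          (A.init (spinEnergyWord s k)) c →
        c.state ∉ C → c.head A.inputTape ≤ n + 1 ∧ ¬ A.Accepting c) ∧
      (∃ c, Relation.ReflTransGen (fun c c' => c.state ∉ C ∧ A.Step c c')
          (A.init (spinEnergyWord s k)) c ∧ c.state ∈ C) ∧
      (∀ c, Relation.ReflTransGen (fun c c' => c.state ∉ C ∧ A.Step c c')
          (A.init (spinEnergyWord s k)) c → c.state ∈ C →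
        (binary (M.hamiltonian s)).length ≤ (spinEnergyWord s k).length ∧
        c.tape T = A.tapeOf (spinEnergyWord s k).length ((binary (M.hamiltonian s)).map bit) ∧
        ∀ z : ℤ, (binary z).length ≤ (spinEnergyWord s k).length →
          (A.AcceptsFrom { c with
              tape := Function.update c.tape T
                (A.tapeOf (spinEnergyWord s k).length ((binary z).map bit)) } ↔ z = k))

namespace IsingModel

/-- The language of `M` is decided by a constructive pushdown automaton. -/
def ConstructiveContextFree (M : IsingModel) : Prop :=
  ∃ P : PushdownAutomaton IsingSymbol, P.IsConstructiveFor M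

/-- The language of `M` is decided by a constructive linear bounded automaton. -/
def ConstructiveContextSensitive (M : IsingModel) : Prop :=
  ∃ A : LinearBoundedAutomaton IsingSymbol, A.IsConstructiveFor M

end IsingModel

/-! ### Ising models with a regular language -/

/-! Regular case. For a system size `n`, the left quotient of the language by `0ⁿ•` is a single
word, the unary code of `-|E_n|`. A regular language has finitely many left quotients, so `|E_n|`
takes finitely many values; since there are no isolated vertices, `n ≤ 2|E_n|`, and the sizes are
bounded (`exists_sizes_le_of_isRegular`). A pushdown automaton can then keep the whole configuration
in its state, push the energy from a finite table, and cancel it against the input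
(`tableAutomaton`). It accumulates all edges in one step, and the number of marked configurations on
a run forces this partition to be the only one.

Context-free case. A linear bounded automaton guesses a leftmost derivation in a grammar `g` of the
language. Derived spins are matched with the input, and derived energy letters are only counted, in
binary, on the energy tape. When the derivation is complete, the word `u • v` belongs to the
language and `u •` is a prefix of the input; since the language is the graph of a function, the
count is the energy of the input configuration, and no input energy has been read so far
(`DerivationInvariant.step`). Afterwards the input energy is counted in binary too, and the two
tapes are compared (`acceptsFrom_compare`).

The difficulty is space: the derived word can be quadratically long in `n`, and so may be the height
of its derivation tree. Pruning repetitions of a nonterminal that span energy letters only yields a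
tree whose height is linear in the number of the remaining letters
(`DerivesWithin.exists_filter_eq`). Pruning may change the energy letters, but the result is again
in the language and has the same spins, hence is the same word. A depth-first traversal of this tree
needs a stack of linear height, which fits when several frames share a cell (`Represents.yields`).
The count fits because distinct edges have distinct nonempty vertex sets, so that `|H(s)| ≤ |E_n| <
2ⁿ`. -/

instance : Finite IsingSymbol :=
  Finite.of_surjective (fun i : Fin 5 => match i with
    | 0 => IsingSymbol.zero | 1 => .one | 2 => .sep | 3 => .plus | 4 => .minus) (by
    rintro (_ | _ | _ | _ | _)
    exacts [⟨0, rfl⟩, ⟨1, rfl⟩, ⟨2, rfl⟩, ⟨3, rfl⟩, ⟨4, rfl⟩])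

/-! ### Unique readability of words and energies -/

theorem unary_inj {β : Type} {p m : β} (h : p ≠ m) {z z' : ℤ} (e : unary p m z = unary p m z') :
    z = z' := by
  have hl := congrArg List.length e
  have hlen : ∀ y : ℤ, (unary p m y).length = y.natAbs := fun y => by
    unfold unary; split <;> simp
  rw [hlen, hlen] at hl
  unfold unary at e
  split at e <;> split at e
  · omega
  · rw [hl] at e
    rcases (List.replicate_inj.1 e).2 with h0 | h0
    · omega
    · exact absurd h0 h
  · rw [hl] at e
    rcases (List.replicate_inj.1 e).2 with h0 | h0
    · omega
    · exact absurd h0.symm h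
  · omega

theorem energyWord_inj {z z' : ℤ} (e : energyWord z = energyWord z') : z = z' :=
  unary_inj (by decide) e

theorem mem_energyWord {a : IsingSymbol} {z : ℤ} (h : a ∈ energyWord z) :
    a = .plus ∨ a = .minus := by
  unfold energyWord unary at h
  split at h <;> simp [List.mem_replicate] at h <;> simp [h]

theorem spinSymbol_inj {a b : Bool} (h : spinSymbol a = spinSymbol b) : a = b := by
  cases a <;> cases b <;> simp [spinSymbol] at h ⊢

theorem spinSymbol_ne_sep (b : Bool) : spinSymbol b ≠ .sep := by cases b <;> simp [spinSymbol]

theorem append_sep_inj {u u' v v' : List IsingSymbol} (hu : IsingSymbol.sep ∉ u)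
    (hu' : IsingSymbol.sep ∉ u') (h : u ++ .sep :: v = u' ++ .sep :: v') : u = u' ∧ v = v' := by
  induction u generalizing u' with
  | nil =>
    cases u' with
    | nil => simpa using h
    | cons a u' => simp at h hu'; exact absurd h.1 hu'.1
  | cons b u ih =>
    cases u' with
    | nil => simp at h hu; exact absurd h.1.symm hu.1
    | cons a u' =>
      simp at h hu hu'
      obtain ⟨rfl, h⟩ := h
      obtain ⟨rfl, rfl⟩ := ih hu.2 hu'.2 h
      simp

theorem sep_notMem_spins {n : ℕ} (s : Fin n → Bool) :
    IsingSymbol.sep ∉ List.ofFn (fun i => spinSymbol (s i)) := by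
  simp [List.mem_ofFn, spinSymbol_ne_sep]

theorem ofFn_spinSymbol_inj {n m : ℕ} {s : Fin n → Bool} {t : Fin m → Bool}
    (h : List.ofFn (fun i => spinSymbol (s i)) = List.ofFn (fun i => spinSymbol (t i))) :
    ∃ e : n = m, s = t ∘ Fin.cast e := by
  have hl : n = m := by simpa using congrArg List.length h
  subst hl
  refine ⟨rfl, funext fun i => ?_⟩
  exact spinSymbol_inj (congrFun (List.ofFn_injective h) i)

/-! ### Bounded system sizes; configurations as lists -/

namespace IsingModel

variable (M : IsingModel)

/-- Words of the language of `M` with a given spin part carry the energy of this spin part. -/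
theorem spinEnergyWord_mem_language {n : ℕ} {s : Fin n → Bool} {v : List IsingSymbol} :
    List.ofFn (fun i => spinSymbol (s i)) ++ .sep :: v ∈ M.language ↔
      n ∈ M.sizes ∧ v = energyWord (M.hamiltonian s) := by
  constructor
  · rintro ⟨m, hm, t, h⟩
    obtain ⟨h1, h2⟩ := append_sep_inj (sep_notMem_spins s) (sep_notMem_spins t) h
    obtain ⟨rfl, rfl⟩ := ofFn_spinSymbol_inj h1
    exact ⟨hm, h2⟩
  · rintro ⟨hn, rfl⟩
    exact ⟨n, hn, s, rfl⟩

theorem hamiltonian_const (n : ℕ) (b : Bool) :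
    M.hamiltonian (fun _ : Fin n => b) = -((M.edges n).card : ℤ) := by
  simp [hamiltonian, edgeEnergy]

/-- Every vertex is the first or the second endpoint of an edge, so the two coordinate projections
of the edge set cover all vertices. -/
theorem card_edges_pos {n : ℕ} (hn : n ∈ M.sizes) : n ≤ 2 * (M.edges n).card := by
  classical
  have h : (Finset.univ : Finset (Fin n)) ⊆
      (M.edges n).image Prod.fst ∪ (M.edges n).image Prod.snd := by
    intro i _
    obtain ⟨e, he, h | h⟩ := M.no_isolated n hn i
    · exact Finset.mem_union_left _ (Finset.mem_image.2 ⟨e, he, h⟩)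
    · exact Finset.mem_union_right _ (Finset.mem_image.2 ⟨e, he, h⟩)
  have h1 := Finset.card_le_card h
  have h2 := Finset.card_union_le ((M.edges n).image Prod.fst) ((M.edges n).image Prod.snd)
  have h3 := Finset.card_image_le (s := M.edges n) (f := Prod.fst)
  have h4 := Finset.card_image_le (s := M.edges n) (f := Prod.snd)
  simp at h1
  omega

/-- A regular Ising model has only finitely many system sizes. -/
theorem exists_sizes_le_of_isRegular (h : M.language.IsRegular) : ∃ K, ∀ n ∈ M.sizes, n ≤ K := by
  have hf := h.finite_range_leftQuotient
  let prefixWord : ℕ → List IsingSymbol := fun n =>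
    List.ofFn (fun _ : Fin n => spinSymbol false) ++ [.sep]
  have hq : ∀ n ∈ M.sizes, ∀ v, v ∈ M.language.leftQuotient (prefixWord n) ↔
      v = energyWord (-((M.edges n).card : ℤ)) := by
    intro n hn v
    rw [Language.mem_leftQuotient, ← M.hamiltonian_const n false]
    have := M.spinEnergyWord_mem_language (s := fun _ : Fin n => false) (v := v)
    simp only [prefixWord, List.append_assoc, List.singleton_append]
    rw [this]
    simp [hn]
  have hcard : ((fun n => (M.edges n).card) '' M.sizes).Finite := by
    have hsub : ((fun n => M.language.leftQuotient (prefixWord n)) '' M.sizes).Finite :=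
      hf.subset (by rintro _ ⟨n, _, rfl⟩; exact ⟨_, rfl⟩)
    -- The number of edges can be recovered from the quotient, so finitely many quotients leave
    -- finitely many edge numbers. The infimum is only evaluated on singletons.
    let g : Language IsingSymbol → ℕ := fun L =>
      sInf {c : ℕ | energyWord (-(c : ℤ)) ∈ L}
    refine (hsub.image g).subset ?_
    rintro _ ⟨n, hn, rfl⟩
    refine ⟨_, ⟨n, hn, rfl⟩, ?_⟩
    have : {c : ℕ | energyWord (-(c : ℤ)) ∈ M.language.leftQuotient (prefixWord n)} =
        {(M.edges n).card} := by
      ext c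
      simp only [Set.mem_ofPred_eq, hq n hn, Set.mem_singleton_iff]
      constructor
      · intro h; have := energyWord_inj h; omega
      · rintro rfl; rfl
    simp only [g, this, csInf_singleton]
  obtain ⟨B, hB⟩ := hcard.bddAbove
  refine ⟨2 * B, fun n hn => (M.card_edges_pos hn).trans ?_⟩
  have := hB ⟨n, hn, rfl⟩
  simp only at this
  omega

/-- The energy of a spin configuration given as a list. -/
def listEnergy (l : List Bool) : ℤ := M.hamiltonian (fun i : Fin l.length => l.getD i false)

theorem listEnergy_eq {l : List Bool} {n : ℕ} (h : l.length = n) (s : Fin n → Bool)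
    (hs : ∀ i : Fin n, l.getD i false = s i) : M.listEnergy l = M.hamiltonian s := by
  subst h
  exact congrArg _ (funext hs)

theorem listEnergy_ofFn {n : ℕ} (s : Fin n → Bool) :
    M.listEnergy (List.ofFn s) = M.hamiltonian s :=
  M.listEnergy_eq (by simp) s (fun i => by simp [List.getD_eq_getElem?_getD])

/-- Lists replace functions on `Fin n` because one state set has to hold configurations of all
sizes. -/
theorem mem_language_iff_list {w : List IsingSymbol} : w ∈ M.language ↔
    ∃ t : List Bool, t.length ∈ M.sizes ∧
      w = t.map spinSymbol ++ .sep :: energyWord (M.listEnergy t) := by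
  constructor
  · rintro ⟨n, hn, s, rfl⟩
    refine ⟨List.ofFn s, by simpa using hn, ?_⟩
    rw [M.listEnergy_ofFn, spinEnergyWord, List.map_ofFn]; rfl
  · rintro ⟨t, ht, rfl⟩
    refine ⟨t.length, ht, fun i => t.getD i false, ?_⟩
    rw [spinEnergyWord]
    congr 1
    apply List.ext_getElem <;> simp

end IsingModel

/-! ### The table-lookup pushdown automaton -/

namespace PushdownAutomaton

variable {α : Type}

theorem acceptsFrom_iff (P : PushdownAutomaton α) (c : P.Config) :
    P.AcceptsFrom c ↔ P.Accepting c ∨ ∃ c', P.Step c c' ∧ P.AcceptsFrom c' := by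
  constructor
  · rintro ⟨d, hd, ha⟩
    rcases hd.cases_head with rfl | ⟨c', h, h'⟩
    · exact Or.inl ha
    · exact Or.inr ⟨c', h, d, h', ha⟩
  · rintro (h | ⟨c', h, d, h', ha⟩)
    · exact ⟨c, .refl, h⟩
    · exact ⟨d, .head h h', ha⟩

theorem step_iff (P : PushdownAutomaton α) (q : P.State) (w : List α) (t : P.Stack)
    (γ : List P.Stack) (c : P.Config) : P.Step ⟨q, w, t :: γ⟩ c ↔
      (∃ x w' v q', w = x :: w' ∧ (q, some x, t, q', v) ∈ P.trans ∧ c = ⟨q', w', v ++ γ⟩) ∨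
      ∃ v q', (q, none, t, q', v) ∈ P.trans ∧ c = ⟨q', w, v ++ γ⟩ := by
  constructor
  · intro h
    cases h with
    | read w' γ h => exact Or.inl ⟨_, _, _, _, rfl, h, rfl⟩
    | eps w' γ h => exact Or.inr ⟨_, _, h, rfl⟩
  · rintro (⟨x, w', v, q', rfl, h, rfl⟩ | ⟨v, q', h, rfl⟩)
    · exact .read _ _ h
    · exact .eps _ _ h

theorem not_step_nil (P : PushdownAutomaton α) (q : P.State) (w : List α) (c : P.Config) :
    ¬ P.Step ⟨q, w, []⟩ c := by
  intro h; cases h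

end PushdownAutomaton

namespace IsingModel

variable (M : IsingModel)

/-- The states of the table automaton: it collects up to `K` spins, looks up their energy, and
compares it with the input energy. -/
inductive TableState (K : ℕ) where
  | read (l : {l : List Bool // l.length ≤ K})
  | loaded (l : {l : List Bool // l.length ≤ K})
  | compare
  | final

instance (K : ℕ) : Finite {l : List Bool // l.length ≤ K} := List.finite_length_le Bool K

instance (K : ℕ) : Finite (TableState K) :=
  Finite.of_surjective
    (fun x : ({l : List Bool // l.length ≤ K} ⊕ {l : List Bool // l.length ≤ K}) ⊕ Bool =>
      match x with
      | .inl (.inl l) => TableState.read l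
      | .inl (.inr l) => .loaded l
      | .inr true => .compare
      | .inr false => .final) (by
    rintro (l | l | _ | _)
    exacts [⟨.inl (.inl l), rfl⟩, ⟨.inl (.inr l), rfl⟩, ⟨.inr true, rfl⟩, ⟨.inr false, rfl⟩])

/-- The transitions of the table automaton. -/
inductive TableTrans (K : ℕ) : TableState K → Option IsingSymbol → IsingSymbol → TableState K →
    List IsingSymbol → Prop
  | spin (l : {l : List Bool // l.length ≤ K}) (b : Bool) (h : (l.1 ++ [b]).length ≤ K) :
      TableTrans K (.read l) (some (spinSymbol b)) .sep (.read ⟨l.1 ++ [b], h⟩) [.sep]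
  | load (l : {l : List Bool // l.length ≤ K}) (h : l.1.length ∈ M.sizes) :
      TableTrans K (.read l) (some .sep) .sep (.loaded l) [.sep]
  | push (l : {l : List Bool // l.length ≤ K}) :
      TableTrans K (.loaded l) none .sep .compare (energyWord (M.listEnergy l.1) ++ [.sep])
  | cancel (a : IsingSymbol) (h : a ≠ .sep) : TableTrans K .compare (some a) a .compare []
  | finish : TableTrans K .compare none .sep .final []

/-- The pushdown automaton that looks up the energy of up to `K` spins in a table. -/
abbrev tableAutomaton (K : ℕ) : PushdownAutomaton IsingSymbol where
  State := TableState K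
  Stack := IsingSymbol
  trans := {x | M.TableTrans K x.1 x.2.1 x.2.2.1 x.2.2.2.1 x.2.2.2.2}
  finite_trans := by
    have hV : (Set.range (fun l : {l : List Bool // l.length ≤ K} =>
      energyWord (M.listEnergy l.1) ++ [.sep]) ∪ {[], [.sep]}).Finite :=
      (Set.finite_range _).union (by simp)
    refine (Set.finite_univ.prod (Set.finite_univ.prod
      (Set.finite_univ.prod (Set.finite_univ.prod hV)))).subset ?_
    rintro ⟨q, x, t, q', v⟩ h
    simp only [Set.mem_ofPred_eq] at h
    cases h <;> simp
  start := .read ⟨[], by simp⟩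
  bottom := .sep
  accept := {.final}

section tableAutomaton

variable {M} {K : ℕ}

theorem tableAutomaton_step_compare_cons {w : List IsingSymbol} {a : IsingSymbol} (ha : a ≠ .sep)
    (γ : List IsingSymbol) (c : (M.tableAutomaton K).Config) :
    (M.tableAutomaton K).Step ⟨TableState.compare, w, a :: γ⟩ c ↔
      ∃ w', w = a :: w' ∧ c = ⟨TableState.compare, w', γ⟩ := by
  rw [PushdownAutomaton.step_iff]
  constructor
  · rintro (⟨x, w', v, q', rfl, h, rfl⟩ | ⟨v, q', h, rfl⟩)
    · have h : M.TableTrans K .compare (some x) a q' v := h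
      cases h; exact ⟨w', rfl, rfl⟩
    · cases h; exact absurd rfl ha
  · rintro ⟨w', rfl, rfl⟩
    exact Or.inl ⟨a, w', [], _, rfl, .cancel a ha, rfl⟩

theorem tableAutomaton_step_compare_sep {w : List IsingSymbol}
    (c : (M.tableAutomaton K).Config) (h : (M.tableAutomaton K).Step
      ⟨TableState.compare, w, [IsingSymbol.sep]⟩ c) : c = ⟨TableState.final, w, []⟩ := by
  rw [PushdownAutomaton.step_iff] at h
  obtain (⟨x, w', v, q', rfl, h, rfl⟩ | ⟨v, q', h, rfl⟩) := h
  · have h : M.TableTrans K .compare (some x) .sep q' v := h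
    cases h with | cancel _ h0 => exact absurd rfl h0
  · cases h; rfl

/-- Each letter above the bottom can only be cancelled by the same input letter. The bottom symbol
is `sep`, so the stack word must avoid it; once it is popped the stack is empty and nothing more can
be read. -/
theorem tableAutomaton_acceptsFrom_compare (γ w : List IsingSymbol)
    (hγ : ∀ a ∈ γ, a ≠ .sep) :
    (M.tableAutomaton K).AcceptsFrom ⟨TableState.compare, w, γ ++ [IsingSymbol.sep]⟩ ↔ w = γ := by
  induction γ generalizing w with
  | nil =>
    constructor
    · intro h
      rw [PushdownAutomaton.acceptsFrom_iff] at h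
      rcases h with h | ⟨c, h, h'⟩
      · cases h.2
      · obtain rfl := tableAutomaton_step_compare_sep c h
        rw [PushdownAutomaton.acceptsFrom_iff] at h'
        rcases h' with h' | ⟨c, h, -⟩
        · exact h'.1
        · exact absurd h (PushdownAutomaton.not_step_nil _ _ _ _)
    · rintro rfl
      exact ⟨_, .single (.eps _ [] .finish), rfl, rfl⟩
  | cons a γ ih =>
    rw [PushdownAutomaton.acceptsFrom_iff]
    have ha := hγ a (by simp)
    have hγ' : ∀ b ∈ γ, b ≠ IsingSymbol.sep := fun b hb => hγ b (by simp [hb])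
    constructor
    · rintro (h | ⟨c, h, h'⟩)
      · cases h.2
      · obtain ⟨w', rfl, rfl⟩ := (tableAutomaton_step_compare_cons ha _ _).1 h
        rw [(ih w' hγ').1 h']
    · rintro rfl
      exact Or.inr ⟨_, (tableAutomaton_step_compare_cons ha _ _).2 ⟨γ, rfl, rfl⟩,
        (ih γ hγ').2 rfl⟩

theorem energyWord_ne_sep (z : ℤ) : ∀ a ∈ energyWord z, a ≠ .sep := fun a ha h => by
  rcases mem_energyWord ha with h' | h' <;> simp [h'] at h

theorem tableAutomaton_step_loaded (l : {l : List Bool // l.length ≤ K}) (w : List IsingSymbol)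
    (c : (M.tableAutomaton K).Config) :
    (M.tableAutomaton K).Step ⟨TableState.loaded l, w, [IsingSymbol.sep]⟩ c ↔
      c = ⟨TableState.compare, w, energyWord (M.listEnergy l.1) ++ [IsingSymbol.sep]⟩ := by
  rw [PushdownAutomaton.step_iff]
  constructor
  · rintro (⟨x, w', v, q', rfl, h, rfl⟩ | ⟨v, q', h, rfl⟩)
    · cases h
    · cases h; simp
  · rintro rfl
    exact Or.inr ⟨_, _, .push l, by simp⟩

theorem tableAutomaton_step_read (l : {l : List Bool // l.length ≤ K}) (w : List IsingSymbol)
    (c : (M.tableAutomaton K).Config) :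
    (M.tableAutomaton K).Step ⟨TableState.read l, w, [IsingSymbol.sep]⟩ c ↔
      (∃ b w', ∃ h : (l.1 ++ [b]).length ≤ K, w = spinSymbol b :: w' ∧
        c = ⟨TableState.read ⟨l.1 ++ [b], h⟩, w', [IsingSymbol.sep]⟩) ∨
      ∃ w', l.1.length ∈ M.sizes ∧ w = .sep :: w' ∧
        c = ⟨TableState.loaded l, w', [IsingSymbol.sep]⟩ := by
  rw [PushdownAutomaton.step_iff]
  constructor
  · rintro (⟨x, w', v, q', rfl, h, rfl⟩ | ⟨v, q', h, rfl⟩)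
    · cases h
      · exact Or.inl ⟨_, _, by assumption, rfl, rfl⟩
      · exact Or.inr ⟨_, by assumption, rfl, rfl⟩
    · cases h
  · rintro (⟨b, w', h, rfl, rfl⟩ | ⟨w', h, rfl, rfl⟩)
    · exact Or.inl ⟨_, _, _, _, rfl, .spin l b h, rfl⟩
    · exact Or.inl ⟨_, _, _, _, rfl, .load l h, rfl⟩

/-- Induction on the unread input. The bound `hK` guarantees that the state has room for the next
spin of any configuration that can still be completed to a system size. -/
theorem tableAutomaton_acceptsFrom_read (hK : ∀ n ∈ M.sizes, n ≤ K)
    (w : List IsingSymbol) (l : {l : List Bool // l.length ≤ K}) :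
    (M.tableAutomaton K).AcceptsFrom ⟨TableState.read l, w, [IsingSymbol.sep]⟩ ↔
      ∃ t : List Bool, (l.1 ++ t).length ∈ M.sizes ∧
        w = t.map spinSymbol ++ .sep :: energyWord (M.listEnergy (l.1 ++ t)) := by
  induction w generalizing l with
  | nil =>
    constructor
    · rw [PushdownAutomaton.acceptsFrom_iff]
      rintro (h | ⟨c, h, -⟩)
      · cases h.2
      · rw [tableAutomaton_step_read] at h; simp at h
    · rintro ⟨t, -, h⟩; simp at h
  | cons a w ih =>
    rw [PushdownAutomaton.acceptsFrom_iff]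
    constructor
    · rintro (h | ⟨c, h, h'⟩)
      · cases h.2
      · rw [tableAutomaton_step_read] at h
        rcases h with ⟨b, w', h, e, rfl⟩ | ⟨w', h, e, rfl⟩
        · obtain ⟨rfl, rfl⟩ := List.cons_eq_cons.1 e
          obtain ⟨t, ht, e⟩ := (ih _).1 h'
          exact ⟨b :: t, by simpa using ht, by simpa using e⟩
        · obtain ⟨rfl, rfl⟩ := List.cons_eq_cons.1 e
          rw [PushdownAutomaton.acceptsFrom_iff] at h'
          rcases h' with h' | ⟨c, hc, h'⟩
          · cases h'.2
          · obtain rfl := (tableAutomaton_step_loaded _ _ _).1 hc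
            rw [tableAutomaton_acceptsFrom_compare _ _ (energyWord_ne_sep _)] at h'
            exact ⟨[], by simpa using h, by simpa using h'⟩
    · rintro ⟨t, ht, e⟩
      right
      cases t with
      | nil =>
        simp only [List.map_nil, List.nil_append, List.append_nil] at e ht
        obtain ⟨rfl, rfl⟩ := List.cons_eq_cons.1 e
        refine ⟨_, (tableAutomaton_step_read _ _ _).2 (Or.inr ⟨_, ht, rfl, rfl⟩), ?_⟩
        rw [PushdownAutomaton.acceptsFrom_iff]
        exact Or.inr ⟨_, (tableAutomaton_step_loaded _ _ _).2 rfl,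
          (tableAutomaton_acceptsFrom_compare _ _ (energyWord_ne_sep _)).2 rfl⟩
      | cons b t =>
        simp only [List.map_cons, List.cons_append] at e
        obtain ⟨rfl, rfl⟩ := List.cons_eq_cons.1 e
        have hb : (l.1 ++ [b]).length ≤ K := by
          have := hK _ ht; simp at this ⊢; omega
        refine ⟨_, (tableAutomaton_step_read _ _ _).2 (Or.inl ⟨b, _, hb, rfl, rfl⟩), ?_⟩
        exact (ih _).2 ⟨t, by simpa using ht, by simp⟩

theorem tableAutomaton_language (hK : ∀ n ∈ M.sizes, n ≤ K) :
    (M.tableAutomaton K).language = M.language := by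
  ext w
  rw [M.mem_language_iff_list]
  exact (tableAutomaton_acceptsFrom_read hK w ⟨[], by simp⟩).trans (by simp)

/-- The states in which the table automaton knows all spins. -/
def loadedStates (K : ℕ) : Set (TableState K) :=
  {q | ∃ l : {l : List Bool // l.length ≤ K}, l.1 ≠ [] ∧ q = .loaded l}

/-- On such an input the automaton has no choice before the comparison. A complete description of
the run therefore gives both the existence of a path and the properties required of all paths. -/
theorem tableAutomaton_accumulates (hK : ∀ n ∈ M.sizes, n ≤ K) (u : List IsingSymbol)
    (t : List Bool) (l : {l : List Bool // l.length ≤ K}) (ht : (l.1 ++ t).length ∈ M.sizes)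
    (r : List (M.tableAutomaton K).Config) (d : (M.tableAutomaton K).Config) :
    (M.tableAutomaton K).Accumulates (loadedStates K) {TableState.compare}
      ⟨TableState.read l, t.map spinSymbol ++ .sep :: u, [IsingSymbol.sep]⟩ r d ↔
    r = (if l.1 ++ t = [] then [] else
      [⟨TableState.loaded ⟨l.1 ++ t, hK _ ht⟩, u, [IsingSymbol.sep]⟩]) ∧
    d = ⟨TableState.compare, u, energyWord (M.listEnergy (l.1 ++ t)) ++ [IsingSymbol.sep]⟩ := by
  have hload : ∀ (l : {l : List Bool // l.length ≤ K}) (r : List (M.tableAutomaton K).Config)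
      (d : (M.tableAutomaton K).Config),
      (M.tableAutomaton K).Accumulates (loadedStates K) {TableState.compare}
        ⟨TableState.loaded l, u, [IsingSymbol.sep]⟩ r d ↔
      r = (if l.1 = [] then [] else [⟨TableState.loaded l, u, [IsingSymbol.sep]⟩]) ∧
      d = ⟨TableState.compare, u, energyWord (M.listEnergy l.1) ++ [IsingSymbol.sep]⟩ := by
    intro l r d
    have hcmp : ∀ {γ : List IsingSymbol} {r : List (M.tableAutomaton K).Config}
        {d : (M.tableAutomaton K).Config},
        (M.tableAutomaton K).Accumulates (loadedStates K) {TableState.compare}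
          ⟨TableState.compare, u, γ⟩ r d → r = [] ∧ d = ⟨TableState.compare, u, γ⟩ := by
      intro γ r d h
      cases h with
      | done => exact ⟨rfl, rfl⟩
      | pass h => exact absurd rfl h
      | mark h => exact absurd rfl h
    have hmem : TableState.loaded l ∈ loadedStates K ↔ l.1 ≠ [] := by
      constructor
      · rintro ⟨l', h, e⟩; cases e; exact h
      · exact fun h => ⟨l, h, rfl⟩
    constructor
    · intro h
      cases h with
      | done hC => cases hC
      | pass hC hS h h' =>
        obtain rfl := (tableAutomaton_step_loaded _ _ _).1 h
        obtain ⟨rfl, rfl⟩ := hcmp h'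
        have h0 : l.1 = [] := by_contra fun h => hS (hmem.2 h)
        simp [h0]
      | mark hC hS h h' =>
        obtain rfl := (tableAutomaton_step_loaded _ _ _).1 h
        obtain ⟨rfl, rfl⟩ := hcmp h'
        simp [hmem.1 hS]
    · rintro ⟨rfl, rfl⟩
      have hC : TableState.loaded l ∉ ({TableState.compare} : Set (TableState K)) := by simp
      split
      · rename_i h
        exact .pass hC (fun h' => hmem.1 h' h) ((tableAutomaton_step_loaded _ _ _).2 rfl)
          (.done rfl)
      · rename_i h
        exact .mark hC (hmem.2 h) ((tableAutomaton_step_loaded _ _ _).2 rfl)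
          (.done rfl)
  have hS : ∀ l, TableState.read l ∉ loadedStates K := by
    rintro l ⟨l', -, e⟩; cases e
  have hC : ∀ l, TableState.read l ∉ ({TableState.compare} : Set (TableState K)) := by simp
  induction t generalizing l r with
  | nil =>
    have hl : (⟨l.1 ++ [], hK _ ht⟩ : {l : List Bool // l.length ≤ K}) = l :=
      Subtype.ext (by simp)
    rw [hl]
    simp only [List.append_nil] at ht ⊢
    rw [← hload]
    constructor
    · intro h
      cases h with
      | done h => cases h
      | mark _ h => exact absurd h (hS l)
      | pass _ _ h h' =>
        rw [tableAutomaton_step_read] at h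
        rcases h with ⟨b, w', h, e, rfl⟩ | ⟨w', h, e, rfl⟩
        · simp at e; exact absurd e.1.symm (spinSymbol_ne_sep b)
        · simp at e; subst e; exact h'
    · exact fun h => .pass (hC l) (hS l)
        ((tableAutomaton_step_read _ _ _).2 (Or.inr ⟨u, ht, rfl, rfl⟩)) h
  | cons b t ih =>
    have hb : (l.1 ++ [b]).length ≤ K := by
      have := hK _ ht; simp at this ⊢; omega
    have hih := ih ⟨l.1 ++ [b], hb⟩ (by simpa using ht) r
    simp only [List.append_assoc, List.singleton_append] at hih
    refine Iff.trans ?_ hih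
    constructor
    · intro h
      cases h with
      | done h => cases h
      | mark _ h => exact absurd h (hS l)
      | pass _ _ h h' =>
        rw [tableAutomaton_step_read] at h
        rcases h with ⟨b', w', h, e, rfl⟩ | ⟨w', h, e, rfl⟩
        · simp only [List.map_cons, List.cons_append] at e
          obtain ⟨e1, rfl⟩ := List.cons_eq_cons.1 e
          obtain rfl := spinSymbol_inj e1
          exact h'
        · simp at e; exact absurd e.1 (spinSymbol_ne_sep b)
    · exact fun h => .pass (hC l) (hS l)
        ((tableAutomaton_step_read _ _ _).2 (Or.inl ⟨b, _, hb, rfl, rfl⟩)) h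

/-- The only transition into the accept state starts in the comparison state. -/
theorem tableAutomaton_not_final (c d : (M.tableAutomaton K).Config)
    (hc : c.state ≠ TableState.final)
    (h : Relation.ReflTransGen (fun c c' => c.state ∉ ({TableState.compare} : Set (TableState K)) ∧
      (M.tableAutomaton K).Step c c') c d) : d.state ≠ TableState.final := by
  induction h with
  | refl => exact hc
  | tail _ h _ =>
    obtain ⟨hC, h⟩ := h
    intro e
    cases h with
    | @read q q' x t v w γ h =>
      have h : M.TableTrans K q (some x) t q' v := h
      simp only at e; subst e; cases h
    | eps w γ h => simp only at e; subst e; cases h; exact hC rfl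

/-- The case `n = 0` is separate because parts must be nonempty and there are no edges; accordingly,
the empty list is excluded from the marked states. -/
theorem tableAutomaton_iteratesOver (hK : ∀ n ∈ M.sizes, n ≤ K) {n : ℕ} (hn : n ∈ M.sizes) :
    IteratesOver (M.tableAutomaton K) IsingSymbol.plus IsingSymbol.minus (loadedStates K)
      {TableState.compare} (if n = 0 then [] else [M.edges n]) := by
  -- The default values are never used: the marked configuration on an input with `n` spins carries
  -- a list of length `n`.
  refine ⟨fun _ q i => match q with
    | TableState.loaded l => l.1.getD i false
    | _ => false, fun s k => ?_⟩
  have hinit : (M.tableAutomaton K).init (spinEnergyWord s k) =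
      ⟨TableState.read ⟨[], by simp⟩, (List.ofFn s).map spinSymbol ++ .sep :: energyWord k,
        [IsingSymbol.sep]⟩ := by
    rw [PushdownAutomaton.init, spinEnergyWord, List.map_ofFn]; rfl
  have hacc := fun r d => tableAutomaton_accumulates hK (energyWord k) (List.ofFn s)
    ⟨[], by simp⟩ (by simpa using hn) r d
  rw [hinit]
  refine ⟨⟨_, _, (hacc _ _).2 ⟨rfl, rfl⟩⟩, fun l d h => ?_, fun d hd _ ha => ?_⟩
  · obtain ⟨rfl, rfl⟩ := (hacc _ _).1 h
    rcases Nat.eq_zero_or_pos n with rfl | hpos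
    · have h0 : M.listEnergy (List.ofFn s) = 0 := by
        rw [M.listEnergy_ofFn]; exact Finset.sum_of_isEmpty _
      simp only [List.nil_append, h0]
      simp [PushdownAutomaton.energyStack, energyWord]
    · have h0 : List.ofFn s ≠ [] := by
        intro h; have := congrArg List.length h; simp at this; omega
      simp only [List.nil_append, h0, if_false, hpos.ne', List.length_singleton, true_and]
      refine ⟨?_, ?_⟩
      · intro j c J hc hJ
        cases j with
        | succ j => simp at hc
        | zero =>
          simp at hc hJ
          subst hc hJ
          refine ⟨?_, fun i _ => by simp⟩
          simp [PushdownAutomaton.energyStack, unary]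
      · simp [M.listEnergy_ofFn, hamiltonian, PushdownAutomaton.energyStack, energyWord]
  · exact tableAutomaton_not_final _ _ (by rintro ⟨⟩) hd ha.2

theorem tableAutomaton_isConstructiveFor (hK : ∀ n ∈ M.sizes, n ≤ K) :
    (M.tableAutomaton K).IsConstructiveFor M := by
  refine ⟨tableAutomaton_language hK, IsingSymbol.plus, IsingSymbol.minus, loadedStates K,
    {TableState.compare}, IsingSymbol.noConfusion, ?_, ?_, fun n hn => ?_, ?_⟩
  · exact IsingSymbol.noConfusion
  · exact IsingSymbol.noConfusion
  · have hpart : IsEdgePartition (M.edges n) (if n = 0 then [] else [M.edges n]) := by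
      rcases Nat.eq_zero_or_pos n with rfl | hpos
      · exact ⟨by simp, by simp, fun e => e.1.elim0⟩
      · rw [if_neg hpos.ne']
        obtain ⟨e, he, -⟩ := M.no_isolated n hn ⟨0, hpos⟩
        exact ⟨by simpa using ⟨e, he⟩, by simp, by simp⟩
    -- The number of parts equals the number of marked configurations on any single path, so one
    -- sample input determines it.
    have hlen : ∀ I : List (Finset (Fin n × Fin n)), IteratesOver (M.tableAutomaton K) IsingSymbol.plus IsingSymbol.minus
        (loadedStates K) {TableState.compare} I →
        I.length = (if n = 0 then [] else [M.edges n]).length := by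
      intro I hI
      obtain ⟨st, h⟩ := hI
      obtain ⟨st', h'⟩ := tableAutomaton_iteratesOver hK hn
      obtain ⟨⟨l, d, hl⟩, h2, -⟩ := h (fun _ => false) 0
      rw [← (h2 l d hl).1, ← ((h' (fun _ => false) 0).2.1 l d hl).1]
    refine ⟨_, ⟨hpart, tableAutomaton_iteratesOver hK hn⟩, ?_⟩
    rintro I ⟨⟨-, -, hI⟩, hit⟩
    have hl := hlen I hit
    split at hl
    · rename_i h; simpa [h] using hl
    · rename_i h
      -- A partition with a single part consists of the whole edge set.
      obtain ⟨J, rfl⟩ := List.length_eq_one_iff.1 hl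
      rw [if_neg h]
      congr 1
      ext e
      simp [hI]
  · rintro q rfl z k
    exact (tableAutomaton_acceptsFrom_compare _ _ (energyWord_ne_sep z)).trans
      ⟨fun h => (energyWord_inj h).symm, fun h => by rw [h]⟩

end tableAutomaton

theorem constructiveContextFree_of_isRegular (h : M.language.IsRegular) :
    M.ConstructiveContextFree := by
  obtain ⟨K, hK⟩ := M.exists_sizes_le_of_isRegular h
  exact ⟨M.tableAutomaton K, tableAutomaton_isConstructiveFor hK⟩

end IsingModel


/-! ### Derivation trees of bounded height -/

namespace ContextFreeGrammar

variable {T : Type*}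

/-- `Yields R β w`: the word `w` arises from the string `β` by replacing each nonterminal `A` by
some `u` with `R A u`. -/
inductive Yields {N : Type*} (R : N → List T → Prop) : List (Symbol T N) → List T → Prop
  | nil : Yields R [] []
  | terminal (a : T) {β : List (Symbol T N)} {w : List T} (h : Yields R β w) :
      Yields R (.terminal a :: β) (a :: w)
  | nonterminal {A : N} {β : List (Symbol T N)} {u w : List T} (hA : R A u) (h : Yields R β w) :
      Yields R (.nonterminal A :: β) (u ++ w)

theorem Yields.append {N : Type*} {R : N → List T → Prop} {β γ : List (Symbol T N)} {u v : List T}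
    (h : Yields R β u) (h' : Yields R γ v) : Yields R (β ++ γ) (u ++ v) := by
  induction h with
  | nil => exact h'
  | terminal a _ ih => exact .terminal a ih
  | nonterminal hA _ ih => rw [List.append_assoc]; exact .nonterminal hA ih

theorem Yields.exists_of_append {N : Type*} {R : N → List T → Prop} {β γ : List (Symbol T N)}
    {w : List T} (h : Yields R (β ++ γ) w) :
    ∃ u v, w = u ++ v ∧ Yields R β u ∧ Yields R γ v := by
  induction β generalizing w with
  | nil => exact ⟨[], w, rfl, .nil, h⟩
  | cons x β ih =>
    cases h with
    | terminal a h =>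
      obtain ⟨u, v, rfl, h1, h2⟩ := ih h
      exact ⟨a :: u, v, rfl, .terminal a h1, h2⟩
    | nonterminal hA h =>
      obtain ⟨u, v, rfl, h1, h2⟩ := ih h
      exact ⟨_, v, (List.append_assoc ..).symm, .nonterminal hA h1, h2⟩

/-- Subtrees can be exchanged independently if their yields keep the letters in `p`. The replacement
is only needed for yields that are sublists of `w`, which lets the caller compare their letter
counts with that of `w`. -/
theorem Yields.exists_filter_eq {N : Type*} {R R' : N → List T → Prop} (p : T → Bool)
    {β : List (Symbol T N)} {w : List T} (h : Yields R β w)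
    (hR : ∀ A u, R A u → u.Sublist w → ∃ u', u'.filter p = u.filter p ∧ R' A u') :
    ∃ w', w'.filter p = w.filter p ∧ Yields R' β w' := by
  induction h with
  | nil => exact ⟨[], rfl, .nil⟩
  | terminal a _ ih =>
    obtain ⟨w', h1, h2⟩ := ih fun A u hu hs => hR A u hu (hs.trans (List.sublist_cons_self ..))
    exact ⟨a :: w', by simp [List.filter_cons, h1], .terminal a h2⟩
  | nonterminal hA _ ih =>
    obtain ⟨w', h1, h2⟩ := ih fun A u hu hs => hR A u hu (hs.trans (List.sublist_append_right ..))
    obtain ⟨u', h3, h4⟩ := hR _ _ hA (List.sublist_append_left ..)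
    exact ⟨u' ++ w', by simp [h1, h3], .nonterminal h4 h2⟩

theorem Yields.mono {N : Type*} {R R' : N → List T → Prop} {β : List (Symbol T N)} {w : List T}
    (h : Yields R β w) (hR : ∀ A u, R A u → R' A u) : Yields R' β w := by
  induction h with
  | nil => exact .nil
  | terminal a _ ih => exact .terminal a ih
  | nonterminal hA _ ih => exact .nonterminal (hR _ _ hA) ih

variable (g : ContextFreeGrammar T)

/-- `g.DerivesWithin n A w`: the nonterminal `A` derives the word `w` by a derivation tree of
height at most `n`. -/
def DerivesWithin : ℕ → g.NT → List T → Prop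
  | 0 => fun _ _ => False
  | n + 1 => fun A w => ∃ r ∈ g.rules, r.input = A ∧ Yields (DerivesWithin n) r.output w

variable {g}

theorem DerivesWithin.mono {n m : ℕ} (hnm : n ≤ m) {A : g.NT} {w : List T}
    (h : g.DerivesWithin n A w) : g.DerivesWithin m A w := by
  induction n generalizing m A w with
  | zero => exact h.elim
  | succ n ih =>
    obtain ⟨m, rfl⟩ := Nat.exists_eq_succ_of_ne_zero (by omega : m ≠ 0)
    obtain ⟨r, hr, hA, hy⟩ := h
    exact ⟨r, hr, hA, hy.mono fun B u hu => ih (by omega) hu⟩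

theorem Yields.derives {R : g.NT → List T → Prop}
    (hR : ∀ A u, R A u → g.Derives [.nonterminal A] (u.map .terminal))
    {β : List (Symbol T g.NT)} {w : List T} (h : Yields R β w) :
    g.Derives β (w.map .terminal) := by
  induction h with
  | nil => exact Relation.ReflTransGen.refl
  | terminal a _ ih => exact ih.append_left [.terminal a]
  | @nonterminal A β u w hA _ ih =>
    rw [List.map_append]
    exact ((hR _ _ hA).append_right β).trans (ih.append_left _)

theorem DerivesWithin.derives {n : ℕ} {A : g.NT} {w : List T} (h : g.DerivesWithin n A w) :
    g.Derives [.nonterminal A] (w.map .terminal) := by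
  induction n generalizing A w with
  | zero => exact h.elim
  | succ n ih =>
    obtain ⟨r, hr, rfl, hy⟩ := h
    exact Produces.trans_derives ⟨r, hr, .input_output⟩ (hy.derives fun _ _ => ih)

/-- Induction from the end of the derivation: undoing one production groups the subtrees over the
rule's right-hand side under a new node, which raises the height by at most one. -/
theorem Derives.exists_yields {β : List (Symbol T g.NT)} {w : List T}
    (h : g.Derives β (w.map .terminal)) : ∃ n, Yields (g.DerivesWithin n) β w := by
  induction h using Relation.ReflTransGen.head_induction_on with
  | refl =>
    refine ⟨0, ?_⟩
    induction w with
    | nil => exact .nil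
    | cons a w ih => exact .terminal a ih
  | head h _ ih =>
    obtain ⟨n, hn⟩ := ih
    obtain ⟨r, hr, hrw⟩ := h
    obtain ⟨p, q, rfl, rfl⟩ := hrw.exists_parts
    obtain ⟨u, w3, rfl, h12, h3⟩ := hn.exists_of_append
    obtain ⟨w1, w2, rfl, h1, h2⟩ := h12.exists_of_append
    have hm : ∀ A u, g.DerivesWithin n A u → g.DerivesWithin (n + 1) A u :=
      fun _ _ => DerivesWithin.mono (Nat.le_succ n)
    refine ⟨n + 1, ((h1.mono hm).append ?_).append (h3.mono hm)⟩
    rw [← List.append_nil w2]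
    exact .nonterminal ⟨r, hr, rfl, h2⟩ .nil

theorem Generates.exists_derivesWithin {w : List T} (h : g.Generates (w.map .terminal)) :
    ∃ n, g.DerivesWithin n g.initial w := by
  obtain ⟨n, hn⟩ := Derives.exists_yields h
  refine ⟨n, ?_⟩
  clear h
  cases hn with
  | nonterminal hA h => cases h; simpa using hA

-- The set `F` collects the ancestors since the last loss of a counted letter. In a tree of minimal
-- height none of them can recur below with the same counted letters, so a path has at most as many
-- such nodes in a row as there are left-hand sides of rules. Each lost letter resets `F` and is
-- paid for by `g.rules.card`.
open Classical in
theorem DerivesWithin.exists_filter_eq_of_avoid (p : T → Bool) {N : ℕ} {A : g.NT} {w : List T}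
    (h : g.DerivesWithin N A w) (F : Finset g.NT) (hF : F ⊆ g.rules.image (·.input))
    (hav : ∀ B ∈ F, ∀ w', w'.filter p = w.filter p → ¬ g.DerivesWithin N B w') :
    ∃ w', w'.filter p = w.filter p ∧ g.DerivesWithin
      (g.rules.card * (w.filter p).length +
        ((g.rules.image (·.input)).card - F.card)) A w' := by
  induction N using Nat.strong_induction_on generalizing A w F with
  | _ N ih =>
    -- If a lower tree has the same counted letters, the induction hypothesis applies to it
    -- directly; otherwise the given tree has minimal height.
    by_cases hmin : ∃ N' < N, ∃ w', w'.filter p = w.filter p ∧ g.DerivesWithin N' A w'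
    · obtain ⟨N', hN', w', hw', h'⟩ := hmin
      rw [← hw']
      exact ih N' hN' h' F hF fun B hB w'' hw'' hd =>
        hav B hB w'' (hw''.trans hw') (hd.mono hN'.le)
    · cases N with
      | zero => exact h.elim
      | succ n =>
        have hAF : A ∉ F := fun hA => hav A hA w rfl h
        obtain ⟨r, hr, rfl, hy⟩ := h
        have hF' : insert r.input F ⊆ g.rules.image (·.input) :=
          Finset.insert_subset (Finset.mem_image_of_mem _ hr) hF
        have hc := Finset.card_le_card hF'
        rw [Finset.card_insert_of_notMem hAF] at hc
        have hV : (g.rules.image (·.input)).card ≤ g.rules.card := Finset.card_image_le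
        set V := (g.rules.image (·.input)).card with hVdef
        -- The height allowed for the children. The subtraction does not truncate, since the root
        -- nonterminal is a left-hand side outside of `F`.
        set K := g.rules.card * (w.filter p).length + (V - F.card) - 1 with hK
        obtain ⟨w', hw', hy'⟩ := hy.exists_filter_eq (R' := g.DerivesWithin K) p (by
          intro B u hu hs
          have hs' := hs.filter p
          rcases hs'.length_le.lt_or_eq with hlt | heq
          -- A child with fewer counted letters starts again with nothing forbidden; one lost letter
          -- is worth `g.rules.card ≥ V`.
          · obtain ⟨u', hu', hd⟩ := ih n (Nat.lt_succ_self n) hu ∅ (by simp) (by simp)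
            refine ⟨u', hu', hd.mono ?_⟩
            have : g.rules.card * (u.filter p).length + g.rules.card ≤
                g.rules.card * (w.filter p).length := by
              rw [← Nat.mul_succ]; exact Nat.mul_le_mul_left _ hlt
            simp only [Finset.card_empty]
            omega
          -- A child that retains all counted letters gets the root nonterminal as a further
          -- forbidden one, which is justified by minimality of the height.
          · have he := hs'.eq_of_length heq
            obtain ⟨u', hu', hd⟩ := ih n (Nat.lt_succ_self n) hu (insert r.input F) hF' (by
              intro C hC w'' hw'' hd
              rw [he] at hw''
              rcases Finset.mem_insert.1 hC with rfl | hC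
              · exact hmin ⟨n, Nat.lt_succ_self n, w'', hw'', hd⟩
              · exact hav C hC w'' hw'' (hd.mono (Nat.le_succ n)))
            refine ⟨u', hu', hd.mono ?_⟩
            rw [Finset.card_insert_of_notMem hAF, he]
            omega)
        refine ⟨w', hw', ?_⟩
        have : g.rules.card * (w.filter p).length + (V - F.card) = K + 1 := by omega
        rw [this]
        exact ⟨r, hr, rfl, hy'⟩

/-- Up to the letters outside of `p`, every derivable word has a derivation tree whose height is
linear in the number of letters in `p`. -/
theorem DerivesWithin.exists_filter_eq (p : T → Bool) {N : ℕ} {A : g.NT} {w : List T}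
    (h : g.DerivesWithin N A w) : ∃ w', w'.filter p = w.filter p ∧
      g.DerivesWithin (g.rules.card * ((w.filter p).length + 1)) A w' := by
  classical
  obtain ⟨w', hw', hd⟩ := h.exists_filter_eq_of_avoid p ∅ (by simp) (by simp)
  refine ⟨w', hw', hd.mono ?_⟩
  have hV : (g.rules.image (·.input)).card ≤ g.rules.card := Finset.card_image_le
  rw [Nat.mul_succ]
  omega

end ContextFreeGrammar


/-! ### Binary counters -/

/-- The successor on binary representations (least significant digit first). -/
def incrementBits : List Bool → List Bool
  | [] => [true]
  | false :: l => true :: l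
  | true :: l => false :: incrementBits l

theorem bits_succ (n : ℕ) : (n + 1).bits = incrementBits n.bits := by
  induction n using Nat.strong_induction_on with
  | _ n ih =>
    rcases Nat.even_or_odd' n with ⟨m, rfl | rfl⟩
    · rw [Nat.bit1_bits]
      rcases Nat.eq_zero_or_pos m with rfl | hm
      · simp [incrementBits]
      · rw [Nat.bit0_bits m hm.ne']; rfl
    · rw [Nat.bit1_bits, show 2 * m + 1 + 1 = 2 * (m + 1) by ring,
        Nat.bit0_bits _ (Nat.succ_ne_zero m), ih m (by omega)]
      rfl

theorem incrementBits_replicate (j : ℕ) (l : List Bool) :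
    incrementBits (List.replicate j true ++ l) = List.replicate j false ++ incrementBits l := by
  induction j with
  | zero => rfl
  | succ j ih => simp [List.replicate_succ, incrementBits, ih]

theorem bits_length_mono {m n : ℕ} (h : m ≤ n) : m.bits.length ≤ n.bits.length := by
  rw [Nat.size_eq_bits_len, Nat.size_eq_bits_len]; exact Nat.size_le_size h

theorem bits_injective : Function.Injective Nat.bits := by
  intro a
  induction a using Nat.strong_induction_on with
  | _ a ih =>
    intro b h
    have hb : a.bodd = b.bodd := by rw [Nat.bodd_eq_bits_head, Nat.bodd_eq_bits_head, h]
    have hd : a.div2.bits = b.div2.bits := by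
      rw [Nat.div2_bits_eq_tail, Nat.div2_bits_eq_tail, h]
    rcases Nat.eq_zero_or_pos a with rfl | ha
    · have := congrArg List.length h
      rw [Nat.size_eq_bits_len, Nat.size_eq_bits_len] at this
      exact (Nat.size_eq_zero.1 (this.symm.trans Nat.size_zero)).symm
    · have := ih a.div2 (by rw [Nat.div2_val]; omega) hd
      rw [← Nat.bit_bodd_div2 a, ← Nat.bit_bodd_div2 b, hb, this]

theorem binary_injective : Function.Injective binary := by
  intro y z h
  simp only [binary, List.cons.injEq, decide_eq_decide] at h
  have := bits_injective h.2
  omega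

/-- The sign bit of an energy letter. -/
def signBit (a : IsingSymbol) : Bool := decide (a = .minus)

/-- The binary encoding of the number of letters of `v`, with the sign of its last letter. -/
def countWord (v : List IsingSymbol) : List Bool :=
  (v.getLast?.map signBit).getD false :: v.length.bits

theorem countWord_nil : countWord [] = [false] := by simp [countWord]

theorem countWord_append (v : List IsingSymbol) (a : IsingSymbol) :
    countWord (v ++ [a]) = signBit a :: (v.length + 1).bits := by simp [countWord]

theorem length_countWord (v : List IsingSymbol) :
    (countWord v).length = 1 + v.length.bits.length := by simp [countWord, Nat.add_comm]

theorem length_energyWord (z : ℤ) : (energyWord z).length = z.natAbs := by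
  unfold energyWord unary; split <;> simp

/-- An energy word contains only one sign, so the sign of its last letter, which is what the
automaton keeps, is the sign of the energy. For zero both conventions give `false`. -/
theorem countWord_energyWord (z : ℤ) : countWord (energyWord z) = binary z := by
  rw [countWord, binary, length_energyWord]
  congr 1
  unfold energyWord unary
  split
  · rename_i h
    rw [List.getLast?_replicate]
    split <;> simp [signBit, h]
  · rename_i h
    rw [List.getLast?_replicate, if_neg (by omega)]
    simp [signBit]; omega

/-! ### Tape contents and incrementing a binary counter in place -/

namespace LinearBoundedAutomaton

variable {α : Type} (A : LinearBoundedAutomaton α)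

theorem tapeOf_succ_of_lt {N i : ℕ} (w : List A.Symbol) (h : i < N) :
    A.tapeOf N w (i + 1) = w.getD i A.blank := by simp [tapeOf, h]

theorem tapeOf_last (N : ℕ) (w : List A.Symbol) : A.tapeOf N w (N + 1) = A.endR := by
  simp [tapeOf]

theorem update_tapeOf_set {N i : ℕ} (w : List A.Symbol) (x : A.Symbol) (hi : i < w.length)
    (hN : w.length ≤ N) :
    Function.update (A.tapeOf N w) (i + 1) x = A.tapeOf N (w.set i x) := by
  funext j
  rcases j with _ | j
  · simp [tapeOf]
  · by_cases h : j = i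
    · subst h
      rw [Function.update_self, A.tapeOf_succ_of_lt _ (by omega)]
      simp [List.getD_eq_getElem?_getD, hi]
    · rw [Function.update_of_ne (by simpa using h)]
      simp only [tapeOf, List.getD_eq_getElem?_getD, List.getElem?_set_ne (Ne.symm h)]

theorem update_tapeOf_append {N : ℕ} (w : List A.Symbol) (x : A.Symbol) (hN : w.length < N) :
    Function.update (A.tapeOf N w) (w.length + 1) x = A.tapeOf N (w ++ [x]) := by
  funext j
  rcases j with _ | j
  · simp [tapeOf]
  · by_cases h : j = w.length
    · subst h
      rw [Function.update_self, A.tapeOf_succ_of_lt _ hN]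
      simp [List.getD_eq_getElem?_getD]
    · rw [Function.update_of_ne (by simpa using h)]
      have : w.getD j A.blank = (w ++ [x]).getD j A.blank := by
        rcases Nat.lt_or_gt_of_ne h with h | h
        · simp [List.getD_eq_getElem?_getD, List.getElem?_append_left h]
        · rw [List.getD_eq_default _ _ h.le, List.getD_eq_default]
          simpa using h
      simp only [tapeOf, this]

theorem tapeOf_ne_endL {N i : ℕ} {w : List A.Symbol} (hw : ∀ x ∈ w, x ≠ A.endL) :
    A.tapeOf N w (i + 1) ≠ A.endL := by
  simp only [tapeOf]
  split
  · rw [List.getD_eq_getElem?_getD]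
    rcases h : w[i]? with _ | x
    · exact A.blank_ne_endL
    · exact hw x (List.mem_of_getElem? h)
  · split
    · exact A.endL_ne_endR.symm
    · exact A.blank_ne_endL

theorem tapeOf_ne_endR {N i : ℕ} {w : List A.Symbol} (hw : ∀ x ∈ w, x ≠ A.endR) (hi : i ≤ N) :
    A.tapeOf N w i ≠ A.endR := by
  rcases i with _ | i
  · exact A.endL_ne_endR
  · rw [A.tapeOf_succ_of_lt _ hi, List.getD_eq_getElem?_getD]
    rcases h : w[i]? with _ | x
    · exact A.blank_ne_endR
    · exact hw x (List.mem_of_getElem? h)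

/-- Blanks mark where a word ends, so a blank-free word is determined by the cells, including its
length. This turns cellwise agreement into equality of encodings. -/
theorem tapeOf_inj {N : ℕ} {w w' : List A.Symbol} (hw : ∀ x ∈ w, x ≠ A.blank)
    (hw' : ∀ x ∈ w', x ≠ A.blank) (hN : w.length ≤ N) (hN' : w'.length ≤ N)
    (h : ∀ i < N, A.tapeOf N w (i + 1) = A.tapeOf N w' (i + 1)) : w = w' := by
  apply List.ext_getElem?
  intro i
  by_cases hi : i < N
  · have := h i hi
    rw [A.tapeOf_succ_of_lt _ hi, A.tapeOf_succ_of_lt _ hi, List.getD_eq_getElem?_getD,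
      List.getD_eq_getElem?_getD] at this
    rcases h1 : w[i]? with _ | x <;> rcases h2 : w'[i]? with _ | y
    · rfl
    · rw [h1, h2] at this
      exact absurd this.symm (hw' y (List.mem_of_getElem? h2))
    · rw [h1, h2] at this
      exact absurd this (hw x (List.mem_of_getElem? h1))
    · rw [h1, h2] at this
      exact congrArg some this
  · rw [List.getElem?_eq_none (by omega), List.getElem?_eq_none (by omega)]

/-- A tape on which the number `m` with sign bit `σ` is being incremented: the head is on the
first digit that has not been processed, and all digits before it were carried over. -/
def IncrementTape (bit : Bool → A.Symbol) (N : ℕ) (σ : Bool) (m : ℕ) (t : ℕ → A.Symbol)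
    (h : ℕ) : Prop :=
  ∃ j rest, t = A.tapeOf N ((σ :: (List.replicate j false ++ rest)).map bit) ∧ h = j + 2 ∧
    m.bits = List.replicate j true ++ rest ∧ 1 + m.bits.length ≤ N

variable {A} {bit : Bool → A.Symbol} {N : ℕ} {σ : Bool} {m : ℕ} {t : ℕ → A.Symbol} {h : ℕ}

/-- Cell `0` holds the endmarker and cell `1` the sign, which is overwritten whatever it was; the
carry begins at cell `2`. -/
theorem IncrementTape.init {σ' : Bool} (hN : 1 + m.bits.length ≤ N) :
    A.IncrementTape bit N σ m
      (Function.update (A.tapeOf N ((σ' :: m.bits).map bit)) 1 (bit σ)) 2 := by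
  refine ⟨0, m.bits, ?_, rfl, rfl, hN⟩
  rw [A.update_tapeOf_set (i := 0)]
  · simp
  · simp
  · simp; omega

/-- Since the successor fits on the tape, a carry out of the last digit finds a blank and not the
right endmarker. -/
theorem IncrementTape.symbol (ht : A.IncrementTape bit N σ m t h) (hN : 1 + (m + 1).bits.length ≤ N) :
    t h = bit true ∨ t h = bit false ∨ t h = A.blank := by
  obtain ⟨j, rest, rfl, rfl, hm, hN'⟩ := ht
  rw [hm] at hN'
  rw [bits_succ, hm, incrementBits_replicate] at hN
  cases rest with
  | nil =>
    simp [incrementBits] at hN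
    rw [A.tapeOf_succ_of_lt _ (by omega)]
    simp [List.getD_eq_getElem?_getD]
  | cons b rest =>
    simp at hN'
    rw [A.tapeOf_succ_of_lt _ (by omega)]
    cases b <;> simp [List.getD_eq_getElem?_getD]

theorem IncrementTape.carry (hbit : Function.Injective bit)
    (hb : ∀ b, bit b ≠ A.blank ∧ bit b ≠ A.endL ∧ bit b ≠ A.endR)
    (ht : A.IncrementTape bit N σ m t h) (hs : t h = bit true) :
    A.IncrementTape bit N σ m (Function.update t h (bit false)) (h + 1) := by
  obtain ⟨j, rest, rfl, rfl, hm, hN⟩ := ht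
  have hN' := hN
  rw [hm] at hN'
  -- Past the last digit there is a blank or the endmarker, never a digit.
  cases rest with
  | nil =>
    exfalso
    simp at hN'
    rcases Nat.lt_or_ge (j + 1) N with hj | hj
    · rw [A.tapeOf_succ_of_lt _ hj] at hs
      simp [List.getD_eq_getElem?_getD] at hs
      exact (hb true).1 hs.symm
    · obtain rfl : j + 1 = N := by omega
      rw [A.tapeOf_last] at hs
      exact (hb true).2.2 hs.symm
  | cons b rest =>
    simp at hN'
    rw [A.tapeOf_succ_of_lt _ (by omega)] at hs
    simp [List.getD_eq_getElem?_getD] at hs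
    obtain rfl := hbit hs
    refine ⟨j + 1, rest, ?_, rfl, ?_, hN⟩
    · rw [A.update_tapeOf_set (i := j + 1) _ _ (by simp) (by simp; omega)]
      congr 1
      simp [List.replicate_succ']
    · rw [hm, List.replicate_succ']; simp

/-- That the successor fits is a conclusion here: the cell being written is not the endmarker.
Soundness needs this, because a guessed derivation comes with no bound on its count. -/
theorem IncrementTape.finish (hbit : Function.Injective bit)
    (hb : ∀ b, bit b ≠ A.blank ∧ bit b ≠ A.endL ∧ bit b ≠ A.endR)
    (ht : A.IncrementTape bit N σ m t h) (hs : t h = bit false ∨ t h = A.blank) :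
    Function.update t h (bit true) = A.tapeOf N ((σ :: (m + 1).bits).map bit) ∧
      1 + (m + 1).bits.length ≤ N := by
  obtain ⟨j, rest, rfl, rfl, hm, hN⟩ := ht
  rw [bits_succ]
  rw [hm] at hN ⊢
  rw [incrementBits_replicate]
  cases rest with
  | nil =>
    simp at hN
    have hj : j + 1 < N := by
      by_contra hj
      obtain rfl : j + 1 = N := by omega
      rw [A.tapeOf_last] at hs
      rcases hs with hs | hs
      · exact (hb false).2.2 hs.symm
      · exact A.blank_ne_endR hs.symm
    have := A.update_tapeOf_append ((σ :: (List.replicate j false)).map bit) (bit true)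
      (N := N) (by simpa using hj)
    simp [incrementBits] at this ⊢
    exact ⟨this, by omega⟩
  | cons b rest =>
    simp at hN
    rw [A.tapeOf_succ_of_lt _ (by omega)] at hs
    simp [List.getD_eq_getElem?_getD] at hs
    obtain rfl : b = false := by
      rcases hs with hs | hs
      · exact hbit hs
      · exact absurd hs (hb b).1
    rw [A.update_tapeOf_set (i := j + 1) _ _ (by simp) (by simp; omega)]
    refine ⟨?_, by simp [incrementBits]; omega⟩
    congr 1
    simp [incrementBits]

end LinearBoundedAutomaton


/-! ### The linear bounded automaton of a context-free grammar -/

namespace ContextFreeGrammar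

variable (g : ContextFreeGrammar IsingSymbol)

/-- The strings that can remain to be derived at a node of a derivation tree. -/
def frames : Set (List (Symbol IsingSymbol g.NT)) :=
  {β | β <:+ [.nonterminal g.initial] ∨ ∃ r ∈ g.rules, β <:+ r.output}

theorem finite_frames : g.frames.Finite := by
  have hs : ∀ l : List (Symbol IsingSymbol g.NT), {β | β <:+ l}.Finite := fun l =>
    (l.tails.finite_toSet).subset fun β h => (List.mem_tails _ _).2 h
  have : g.frames = {β | β <:+ [.nonterminal g.initial]} ∪
      ⋃ r ∈ (g.rules : Set (ContextFreeRule IsingSymbol g.NT)), {β | β <:+ r.output} := by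
    ext β; simp [frames]
  rw [this]
  exact (hs _).union (g.rules.finite_toSet.biUnion fun r _ => hs _)

variable {g} in
theorem mem_frames_of_suffix {β γ : List (Symbol IsingSymbol g.NT)} (h : γ ∈ g.frames)
    (hs : β <:+ γ) : β ∈ g.frames := by
  rcases h with h | ⟨r, hr, h⟩
  · exact Or.inl (hs.trans h)
  · exact Or.inr ⟨r, hr, hs.trans h⟩

/-- A stack frame. -/
abbrev Frame := {β : List (Symbol IsingSymbol g.NT) // β ∈ g.frames}

instance : Finite g.Frame := g.finite_frames

/-- A block of at most `B` stack frames. -/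
abbrev Block (B : ℕ) := {l : List g.Frame // l.length ≤ B}

instance (B : ℕ) : Finite (g.Block B) := List.finite_length_le g.Frame B

/-- The tape symbols of the automaton. -/
inductive TapeSymbol (B : ℕ) where
  | letter (a : IsingSymbol)
  | blank
  | endL
  | endR
  | bit (b : Bool)
  | block (b : g.Block B)

instance (B : ℕ) : Finite (g.TapeSymbol B) :=
  Finite.of_surjective (fun x : (IsingSymbol ⊕ Fin 3) ⊕ (Bool ⊕ g.Block B) => match x with
    | .inl (.inl a) => TapeSymbol.letter a
    | .inl (.inr 0) => .blank
    | .inl (.inr 1) => .endL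
    | .inl (.inr 2) => .endR
    | .inr (.inl b) => .bit b
    | .inr (.inr b) => .block b) (by
    rintro (a | _ | _ | _ | b | b)
    exacts [⟨.inl (.inl a), rfl⟩, ⟨.inl (.inr 0), rfl⟩, ⟨.inl (.inr 1), rfl⟩,
      ⟨.inl (.inr 2), rfl⟩, ⟨.inr (.inl b), rfl⟩, ⟨.inr (.inr b), rfl⟩])

/-- The purpose of an increment: counting a derived energy letter (with the topmost stack block
kept), or counting an energy letter of the input (with its sign kept). -/
abbrev CountMode (B : ℕ) := g.Block B ⊕ Option Bool

/-- The states of the automaton. In the states `main top e`, it derives a word, where `e` says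
whether the separator has been derived. The states `inc` and `ret` belong to the binary counters.
In the state `compare`, the energy has been computed. The states `rest` count the input energy,
whose sign is known after its first letter. -/
inductive LBAState (B : ℕ) where
  | start
  | main (top : g.Block B) (e : Bool)
  | pop (e : Bool)
  | inc (m : g.CountMode B)
  | ret (m : g.CountMode B)
  | compare
  | rest (σ : Option Bool)
  | check
  | final

instance (B : ℕ) : Finite (g.LBAState B) :=
  Finite.of_surjective (fun x : (Fin 4 ⊕ (g.Block B × Bool)) ⊕
      (Bool ⊕ Option Bool) ⊕ (g.CountMode B ⊕ g.CountMode B) => match x with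
    | .inl (.inl 0) => LBAState.start
    | .inl (.inl 1) => .compare
    | .inl (.inl 2) => .check
    | .inl (.inl 3) => .final
    | .inl (.inr (b, e)) => .main b e
    | .inr (.inl (.inl e)) => .pop e
    | .inr (.inl (.inr σ)) => .rest σ
    | .inr (.inr (.inl m)) => .inc m
    | .inr (.inr (.inr m)) => .ret m) (by
    rintro (_ | ⟨b, e⟩ | e | m | m | _ | σ | _ | _)
    exacts [⟨.inl (.inl 0), rfl⟩, ⟨.inl (.inr (b, e)), rfl⟩, ⟨.inr (.inl (.inl e)), rfl⟩,
      ⟨.inr (.inr (.inl m)), rfl⟩, ⟨.inr (.inr (.inr m)), rfl⟩, ⟨.inl (.inl 1), rfl⟩,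
      ⟨.inr (.inl (.inr σ)), rfl⟩, ⟨.inl (.inl 2), rfl⟩, ⟨.inl (.inl 3), rfl⟩])

/-- The tapes of the automaton. -/
inductive LBATape where
  | input | energy | counter | stack
  deriving DecidableEq

instance : Finite LBATape :=
  Finite.of_surjective (fun i : Fin 4 => match i with
    | 0 => LBATape.input | 1 => .energy | 2 => .counter | 3 => .stack) (by
    rintro (_ | _ | _ | _)
    exacts [⟨0, rfl⟩, ⟨1, rfl⟩, ⟨2, rfl⟩, ⟨3, rfl⟩])

variable {g} in
/-- The tape of a counter. -/
def CountMode.tape {B : ℕ} : g.CountMode B → LBATape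
  | .inl _ => .energy
  | .inr _ => .counter

variable {g} in
/-- The state in which the computation continues after an increment. -/
def CountMode.resume {B : ℕ} : g.CountMode B → g.LBAState B
  | .inl top => .main top true
  | .inr σ => .rest σ

/-- All heads stay. -/
def noMove : LBATape → HeadMove := fun _ => .stay

open Function (update)

/-- The transitions of the automaton. -/
inductive LBATrans (B : ℕ) : g.LBAState B → (LBATape → g.TapeSymbol B) → g.LBAState B →
    (LBATape → g.TapeSymbol B) → (LBATape → HeadMove) → Prop
  | start (a : LBATape → g.TapeSymbol B) (top : g.Block B)
      (htop : top.1 = [⟨[.nonterminal g.initial], Or.inl List.suffix_rfl⟩])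
      (hT : a .energy = .blank) (hK : a .counter = .blank) :
      LBATrans B .start a (.main top false)
        (update (update a .energy (.bit false)) .counter (.bit false)) noMove
  | spin (a : LBATape → g.TapeSymbol B) (top top' : g.Block B) (f f' : g.Frame)
      (fs : List g.Frame) (x : IsingSymbol) (htop : top.1 = f :: fs) (hf : f.1 = .terminal x :: f'.1)
      (htop' : top'.1 = f' :: fs) (hx : a .input = .letter x) (hsep : x ≠ .sep) :
      LBATrans B (.main top false) a (.main top' false) a (update noMove .input .right)
  | sep (a : LBATape → g.TapeSymbol B) (top top' : g.Block B) (f f' : g.Frame)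
      (fs : List g.Frame) (htop : top.1 = f :: fs) (hf : f.1 = .terminal .sep :: f'.1)
      (htop' : top'.1 = f' :: fs) (hx : a .input = .letter .sep) :
      LBATrans B (.main top false) a (.main top' true) a noMove
  | emit (a : LBATape → g.TapeSymbol B) (top top' : g.Block B) (f f' : g.Frame)
      (fs : List g.Frame) (x : IsingSymbol) (htop : top.1 = f :: fs) (hf : f.1 = .terminal x :: f'.1)
      (htop' : top'.1 = f' :: fs) :
      LBATrans B (.main top true) a (.inc (.inl top')) (update a .energy (.bit (signBit x)))
        (update noMove .energy .right)
  | expand (a : LBATape → g.TapeSymbol B) (e : Bool) (top top' : g.Block B) (f f' fr : g.Frame)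
      (fs : List g.Frame) (r : ContextFreeRule IsingSymbol g.NT) (hr : r ∈ g.rules)
      (htop : top.1 = f :: fs) (hf : f.1 = .nonterminal r.input :: f'.1) (hfr : fr.1 = r.output)
      (htop' : top'.1 = fr :: f' :: fs) :
      LBATrans B (.main top e) a (.main top' e) a noMove
  | expandSpill (a : LBATape → g.TapeSymbol B) (e : Bool) (top top' b : g.Block B)
      (f f' fr : g.Frame) (fs : List g.Frame) (r : ContextFreeRule IsingSymbol g.NT)
      (hr : r ∈ g.rules) (htop : top.1 = f :: fs) (hf : f.1 = .nonterminal r.input :: f'.1)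
      (hfr : fr.1 = r.output) (hb : b.1 = f' :: fs) (htop' : top'.1 = [fr]) :
      LBATrans B (.main top e) a (.main top' e) (update a .stack (.block b))
        (update noMove .stack .right)
  | drop (a : LBATape → g.TapeSymbol B) (e : Bool) (top top' : g.Block B) (f : g.Frame)
      (htop : top.1 = f :: top'.1) (hf : f.1 = []) :
      LBATrans B (.main top e) a (.main top' e) a noMove
  | pop (a : LBATape → g.TapeSymbol B) (e : Bool) (top : g.Block B) (htop : top.1 = []) :
      LBATrans B (.main top e) a (.pop e) a (update noMove .stack .left)
  | load (a : LBATape → g.TapeSymbol B) (e : Bool) (top : g.Block B) (h : a .stack = .block top) :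
      LBATrans B (.pop e) a (.main top e) a noMove
  | done (a : LBATape → g.TapeSymbol B) (h : a .stack = .endL) :
      LBATrans B (.pop true) a .compare a noMove
  | carry (a : LBATape → g.TapeSymbol B) (m : g.CountMode B) (h : a m.tape = .bit true) :
      LBATrans B (.inc m) a (.inc m) (update a m.tape (.bit false)) (update noMove m.tape .right)
  | finish (a : LBATape → g.TapeSymbol B) (m : g.CountMode B)
      (h : a m.tape = .bit false ∨ a m.tape = .blank) :
      LBATrans B (.inc m) a (.ret m) (update a m.tape (.bit true)) (update noMove m.tape .left)
  | back (a : LBATape → g.TapeSymbol B) (m : g.CountMode B) (b : Bool) (h : a m.tape = .bit b) :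
      LBATrans B (.ret m) a (.ret m) a (update noMove m.tape .left)
  | resume (a : LBATape → g.TapeSymbol B) (m : g.CountMode B) (h : a m.tape = .endL) :
      LBATrans B (.ret m) a m.resume a (update noMove m.tape .right)
  | go (a : LBATape → g.TapeSymbol B) :
      LBATrans B .compare a (.rest none) a (update noMove .input .right)
  | count (a : LBATape → g.TapeSymbol B) (σ : Option Bool) (x : IsingSymbol)
      (hx : a .input = .letter x) (hx' : x = .plus ∨ x = .minus)
      (hσ : σ = none ∨ σ = some (signBit x)) :
      LBATrans B (.rest σ) a (.inc (.inr (some (signBit x))))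
        (update a .counter (.bit (signBit x)))
        (update (update noMove .input .right) .counter .right)
  | countDone (a : LBATape → g.TapeSymbol B) (σ : Option Bool) (hx : a .input = .endR) :
      LBATrans B (.rest σ) a .check a noMove
  | check (a : LBATape → g.TapeSymbol B) (h : a .energy = a .counter) :
      LBATrans B .check a .check a (update (update noMove .energy .right) .counter .right)
  | accept (a : LBATape → g.TapeSymbol B) (h : a .energy = .endR) (h' : a .counter = .endR) :
      LBATrans B .check a .final a noMove

/-- The linear bounded automaton that derives a word `x • v` from the grammar `g` for the prefix
`x •` of its input, counts `v` in binary on its energy tape, and finally compares this count with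
the remaining input. Stack frames are stored in blocks of size up to `B`. -/
abbrev toLBA (B : ℕ) : LinearBoundedAutomaton IsingSymbol where
  State := g.LBAState B
  Symbol := g.TapeSymbol B
  Tape := LBATape
  letter := .letter
  letter_injective := fun _ _ h => by cases h; rfl
  blank := .blank
  endL := .endL
  endR := .endR
  blank_ne_endL := by simp
  blank_ne_endR := by simp
  endL_ne_endR := by simp
  letter_ne_blank := by simp
  letter_ne_endL := by simp
  letter_ne_endR := by simp
  inputTape := .input
  -- Respect for the endmarkers is imposed on every transition from outside. A rule that would
  -- violate it is simply not available, which is how a computation that runs out of space dies.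
  trans q a q' b d := g.LBATrans B q a q' b d ∧
    (∀ i, a i = .endL → b i = .endL ∧ d i ≠ .left) ∧
    (∀ i, a i = .endR → b i = .endR ∧ d i ≠ .right)
  trans_endL := fun _ _ _ _ _ h => h.2.1
  trans_endR := fun _ _ _ _ _ h => h.2.2
  start := .start
  accept := {.final}

end ContextFreeGrammar


namespace ContextFreeGrammar

open Function (update)

variable {g : ContextFreeGrammar IsingSymbol} {B : ℕ}

/-! ### The automaton only derives words of the language -/

/-- The word derived so far: `u`, or `u • v` if the separator has been derived. -/
def derivedWord (e : Bool) (u v : List IsingSymbol) : List IsingSymbol :=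
  u ++ if e then .sep :: v else []

/-- The stack tape holds the blocks `L` (topmost block first). -/
def StackTape : List (g.Block B) → (ℕ → g.TapeSymbol B) → Prop
  | [], t => t 0 = .endL
  | b :: L, t => t (L.length + 1) = .block b ∧ StackTape L t

/-- The sentential form given by a derived word and the frames on the stack. -/
def sententialForm (x : List IsingSymbol) (fs : List g.Frame) (L : List (g.Block B)) :
    List (Symbol IsingSymbol g.NT) :=
  x.map .terminal ++ (fs.flatMap (·.1) ++ L.flatMap (fun b => b.1.flatMap (·.1)))

/-- The part of the configuration that is common to all states before the comparison: on input `w`,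
the word `u` (and `• v` if `e` is true) has been derived. -/
structure DerivationPhase (w u v : List IsingSymbol) (e : Bool) (t : LBATape → ℕ → g.TapeSymbol B)
    (h : LBATape → ℕ) : Prop where
  input : t .input = (g.toLBA B).tapeOf w.length (w.map .letter)
  head_input : h .input = u.length + 1
  sep_notMem : .sep ∉ u
  word : ∃ rest, w = u ++ rest ∧ (e = true → ∃ r, rest = .sep :: r) ∧ (e = false → v = [])
  counter : t .counter = (g.toLBA B).tapeOf w.length [.bit false]
  head_counter : h .counter = 1
  length_pos : 1 ≤ w.length

/-- The energy tape holds the count of `v`. -/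
def EnergyTape (w v : List IsingSymbol) (t : LBATape → ℕ → g.TapeSymbol B) : Prop :=
  t .energy = (g.toLBA B).tapeOf w.length ((countWord v).map .bit) ∧
    (countWord v).length ≤ w.length

/-- The invariant of the automaton before the comparison. -/
def DerivationInvariant (w : List IsingSymbol) :
    g.LBAState B → (LBATape → ℕ → g.TapeSymbol B) → (LBATape → ℕ) → Prop
  | .start, t, h => t = ((g.toLBA B).init w).tape ∧ h = fun _ => 1
  | .main top e, t, h => ∃ u v L, DerivationPhase w u v e t h ∧ StackTape L (t .stack) ∧
      g.Derives [.nonterminal g.initial] (sententialForm (derivedWord e u v) top.1 L) ∧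
      h .stack = L.length + 1 ∧ EnergyTape w v t ∧ h .energy = 1
  | .pop e, t, h => ∃ u v, ∃ L : List (g.Block B), DerivationPhase w u v e t h ∧
      StackTape L (t .stack) ∧
      g.Derives [.nonterminal g.initial] (sententialForm (derivedWord e u v) [] L) ∧
      h .stack = L.length ∧ EnergyTape w v t ∧ h .energy = 1
  | .inc (.inl top), t, h => ∃ u v x L, DerivationPhase w u (v ++ [x]) true t h ∧
      StackTape L (t .stack) ∧
      g.Derives [.nonterminal g.initial] (sententialForm (derivedWord true u (v ++ [x])) top.1 L) ∧
      h .stack = L.length + 1 ∧ (g.toLBA B).IncrementTape TapeSymbol.bit w.length (signBit x)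
        v.length (t .energy) (h .energy)
  | .ret (.inl top), t, h => ∃ u v L, DerivationPhase w u v true t h ∧ StackTape L (t .stack) ∧
      g.Derives [.nonterminal g.initial] (sententialForm (derivedWord true u v) top.1 L) ∧
      h .stack = L.length + 1 ∧ EnergyTape w v t
  | .compare, t, h => ∃ u v, DerivationPhase w u v true t h ∧
      u ++ .sep :: v ∈ g.language ∧ EnergyTape w v t ∧ h .energy = 1
  | _, _, _ => False

theorem DerivationPhase.congr {w u v : List IsingSymbol} {e : Bool}
    {t t' : LBATape → ℕ → g.TapeSymbol B} {h h' : LBATape → ℕ}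
    (H : DerivationPhase w u v e t h) (h1 : t' .input = t .input) (h2 : h' .input = h .input)
    (h3 : t' .counter = t .counter) (h4 : h' .counter = h .counter) :
    DerivationPhase w u v e t' h' :=
  ⟨h1 ▸ H.input, h2 ▸ H.head_input, H.sep_notMem, H.word, h3 ▸ H.counter, h4 ▸ H.head_counter,
    H.length_pos⟩

theorem EnergyTape.congr {w v : List IsingSymbol} {t t' : LBATape → ℕ → g.TapeSymbol B}
    (H : EnergyTape w v t) (h : t' .energy = t .energy) : EnergyTape w v t' := ⟨h ▸ H.1, H.2⟩

theorem StackTape.update {L : List (g.Block B)} {t : ℕ → g.TapeSymbol B} (H : StackTape L t)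
    {i : ℕ} (hi : L.length < i) (s : g.TapeSymbol B) : StackTape L (Function.update t i s) := by
  induction L with
  | nil =>
    have : (0 : ℕ) ≠ i := by rintro rfl; exact absurd hi (by simp)
    simpa [StackTape, Function.update_of_ne this] using H
  | cons b L ih =>
    simp at hi
    refine ⟨?_, ih H.2 (by omega)⟩
    rw [Function.update_of_ne (by omega)]
    exact H.1

theorem input_symbol {u r : List IsingSymbol} {x : IsingSymbol} :
    (g.toLBA B).tapeOf (u ++ x :: r).length ((u ++ x :: r).map .letter) (u.length + 1) =
      .letter x := by
  rw [LinearBoundedAutomaton.tapeOf_succ_of_lt _ _ (by simp)]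
  simp [List.getD_eq_getElem?_getD]

theorem input_symbol_nil {u : List IsingSymbol} :
    (g.toLBA B).tapeOf u.length (u.map .letter) (u.length + 1) = .endR :=
  LinearBoundedAutomaton.tapeOf_last _ _ _

theorem exists_cons_of_input_symbol {w u r : List IsingSymbol} {x : IsingSymbol} (hw : w = u ++ r)
    (h : (g.toLBA B).tapeOf w.length (w.map .letter) (u.length + 1) = .letter x) :
    ∃ r', r = x :: r' := by
  subst hw
  cases r with
  | nil => rw [List.append_nil, input_symbol_nil] at h; cases h
  | cons y r => rw [input_symbol] at h; cases h; exact ⟨r, rfl⟩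

theorem eq_nil_of_input_symbol {w u r : List IsingSymbol} (hw : w = u ++ r)
    (h : (g.toLBA B).tapeOf w.length (w.map .letter) (u.length + 1) = .endR) : r = [] := by
  subst hw
  cases r with
  | nil => rfl
  | cons y r => rw [input_symbol] at h; cases h

theorem bit_injective : Function.Injective (TapeSymbol.bit : Bool → g.TapeSymbol B) :=
  fun _ _ h => by cases h; rfl

theorem bit_ne (b : Bool) : (TapeSymbol.bit b : g.TapeSymbol B) ≠ (g.toLBA B).blank ∧
    TapeSymbol.bit b ≠ (g.toLBA B).endL ∧ TapeSymbol.bit b ≠ (g.toLBA B).endR := by simp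

/-- While a head returns after an increment, the invariants do not record its position; reading the
left endmarker reveals it. -/
theorem eq_zero_of_bitTape_eq_endL {N i : ℕ} {l : List Bool}
    (h : (g.toLBA B).tapeOf N (l.map .bit) i = .endL) : i = 0 := by
  cases i with
  | zero => rfl
  | succ i => exact absurd h (LinearBoundedAutomaton.tapeOf_ne_endL _ (by simp +contextual [or_imp, eq_comm]))

theorem sententialForm_terminal {w : List IsingSymbol} {x : IsingSymbol} {f f' : g.Frame}
    {fs : List g.Frame} {L : List (g.Block B)} (hf : f.1 = .terminal x :: f'.1) :
    sententialForm w (f :: fs) L = sententialForm (w ++ [x]) (f' :: fs) L := by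
  simp [sententialForm, hf]

theorem produces_sententialForm {w : List IsingSymbol} {f f' fr : g.Frame}
    {fs : List g.Frame} {L : List (g.Block B)} {r : ContextFreeRule IsingSymbol g.NT}
    (hr : r ∈ g.rules) (hf : f.1 = .nonterminal r.input :: f'.1) (hfr : fr.1 = r.output) :
    g.Produces (sententialForm w (f :: fs) L) (sententialForm w (fr :: f' :: fs) L) := by
  refine ⟨r, hr, ?_⟩
  have := r.rewrites_of_exists_parts (w.map .terminal)
    (f'.1 ++ (fs.flatMap (·.1) ++ L.flatMap (fun b => b.1.flatMap (·.1))))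
  simpa [sententialForm, hf, hfr] using this

/-- A step changes the cells under the heads and moves the heads. -/
theorem toLBA_step_iff {q q' : g.LBAState B} {t t' : LBATape → ℕ → g.TapeSymbol B}
    {h h' : LBATape → ℕ} : (g.toLBA B).Step ⟨q, t, h⟩ ⟨q', t', h'⟩ ↔
      ∃ b d, (g.toLBA B).trans q (fun i => t i (h i)) q' b d ∧
        t' = (fun i => update (t i) (h i) (b i)) ∧ h' = fun i => (d i).apply (h i) := by
  simp only [LinearBoundedAutomaton.Step, funext_iff]

/-- The derived word followed by the frames from the top down is a sentential form of a leftmost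
derivation. Expanding a nonterminal is a production; all other steps leave this string unchanged or
only move its letters between derived word, state and tape. -/
theorem DerivationInvariant.step {w : List IsingSymbol} {q q' : g.LBAState B}
    {t t' : LBATape → ℕ → g.TapeSymbol B} {h h' : LBATape → ℕ} (hq : q ≠ .compare)
    (hI : DerivationInvariant w q t h) (hs : (g.toLBA B).Step ⟨q, t, h⟩ ⟨q', t', h'⟩) :
    DerivationInvariant w q' t' h' := by
  obtain ⟨b, d, ⟨htr, -, -⟩, rfl, rfl⟩ := toLBA_step_iff.1 hs
  cases htr with
  | start _ top htop hT hK =>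
    obtain ⟨rfl, rfl⟩ := hI
    -- On the empty input, cell `1` holds the right endmarker, so the first step, which requires a
    -- blank, is impossible.
    have hN : 1 ≤ w.length := by
      by_contra hN
      obtain rfl : w = [] := List.eq_nil_of_length_eq_zero (by omega)
      simp [LinearBoundedAutomaton.init, LinearBoundedAutomaton.tapeOf] at hT
    have hbit := (g.toLBA B).update_tapeOf_append (N := w.length) [] (TapeSymbol.bit false) hN
    refine ⟨[], [], [], ⟨?_, rfl, by simp, ⟨w, rfl, by simp, by simp⟩, ?_, rfl, hN⟩, ?_, ?_, rfl,
      ⟨?_, ?_⟩, rfl⟩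
    · simp [LinearBoundedAutomaton.init]
    · simpa [LinearBoundedAutomaton.init] using hbit
    · simp [StackTape, LinearBoundedAutomaton.init, LinearBoundedAutomaton.tapeOf]
    · simpa [sententialForm, derivedWord, htop] using Relation.ReflTransGen.refl
    · simpa [LinearBoundedAutomaton.init, countWord] using hbit
    · simpa [countWord] using hN
  | spin _ top top' f f' fs x htop hf htop' hx hsep =>
    obtain ⟨u, v, L, H, hS, hD, hhS, hE, hhE⟩ := hI
    obtain ⟨rest, hw, -, hv⟩ := H.word
    obtain rfl := hv rfl
    beta_reduce at hx
    rw [H.input, H.head_input] at hx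
    obtain ⟨r, rfl⟩ := exists_cons_of_input_symbol hw hx
    refine ⟨u ++ [x], [], L, ⟨?_, ?_, ?_, ⟨r, by simp [hw], by simp, by simp⟩, ?_, ?_,
      H.length_pos⟩, ?_, ?_, hhS, hE.congr ?_, hhE⟩
    · simpa using H.input
    · simp [HeadMove.apply, H.head_input]
    · simpa [H.sep_notMem] using hsep.symm
    · simpa using H.counter
    · simpa [noMove, HeadMove.apply] using H.head_counter
    · simpa using hS
    · rw [htop, sententialForm_terminal hf, ← htop'] at hD
      simpa [derivedWord] using hD
    · simp
  | sep _ top top' f f' fs htop hf htop' hx =>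
    obtain ⟨u, v, L, H, hS, hD, hhS, hE, hhE⟩ := hI
    obtain ⟨rest, hw, -, hv⟩ := H.word
    obtain rfl := hv rfl
    beta_reduce at hx
    rw [H.input, H.head_input] at hx
    obtain ⟨r, rfl⟩ := exists_cons_of_input_symbol hw hx
    refine ⟨u, [], L, ⟨?_, ?_, H.sep_notMem, ⟨_, hw, by simp, by simp⟩, ?_, ?_,
      H.length_pos⟩, ?_, ?_, hhS, hE.congr ?_, hhE⟩
    · simpa using H.input
    · simp [noMove, HeadMove.apply, H.head_input]
    · simpa using H.counter
    · simpa [noMove, HeadMove.apply] using H.head_counter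
    · simpa using hS
    · rw [htop, sententialForm_terminal hf, ← htop'] at hD
      simpa [derivedWord] using hD
    · simp
  | emit _ top top' f f' fs x htop hf htop' =>
    obtain ⟨u, v, L, H, hS, hD, hhS, hE, hhE⟩ := hI
    obtain ⟨rest, hw, hr, -⟩ := H.word
    refine ⟨u, v, x, L, ⟨?_, ?_, H.sep_notMem, ⟨_, hw, hr, by simp⟩, ?_, ?_,
      H.length_pos⟩, ?_, ?_, hhS, ?_⟩
    · simpa using H.input
    · simp [noMove, HeadMove.apply, H.head_input]
    · simpa using H.counter
    · simpa [noMove, HeadMove.apply] using H.head_counter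
    · simpa using hS
    · rw [htop, sententialForm_terminal hf, ← htop'] at hD
      simpa [derivedWord] using hD
    · have hl := hE.2
      rw [length_countWord] at hl
      simpa [hhE, HeadMove.apply, hE.1, countWord] using
        LinearBoundedAutomaton.IncrementTape.init (A := g.toLBA B) (bit := TapeSymbol.bit)
          (σ := signBit x) (σ' := (v.getLast?.map signBit).getD false) hl
  | expand _ e top top' f f' fr fs r hr htop hf hfr htop' =>
    obtain ⟨u, v, L, H, hS, hD, hhS, hE, hhE⟩ := hI
    refine ⟨u, v, L, H.congr ?_ rfl ?_ rfl, ?_, ?_, hhS, hE.congr ?_, hhE⟩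
    · simp
    · simp
    · simpa using hS
    · rw [htop'] ; rw [htop] at hD
      exact hD.tail (produces_sententialForm hr hf hfr)
    · simp
  | expandSpill _ e top top' b f f' fr fs r hr htop hf hfr hb htop' =>
    obtain ⟨u, v, L, H, hS, hD, hhS, hE, hhE⟩ := hI
    refine ⟨u, v, b :: L, H.congr ?_ rfl ?_ rfl, ⟨?_, ?_⟩, ?_, ?_, hE.congr ?_, hhE⟩
    · simp
    · simp
    · simp [hhS]
    · simpa [hhS] using hS.update (by omega) _
    · rw [htop]  at hD
      have := hD.tail (produces_sententialForm hr hf hfr)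
      simpa [sententialForm, htop', hb] using this
    · simp [hhS, HeadMove.apply]
    · simp
  | drop _ e top top' f htop hf =>
    obtain ⟨u, v, L, H, hS, hD, hhS, hE, hhE⟩ := hI
    refine ⟨u, v, L, H.congr ?_ rfl ?_ rfl, ?_, ?_, hhS, hE.congr ?_, hhE⟩
    · simp
    · simp
    · simpa using hS
    · rw [htop] at hD
      simpa [sententialForm, hf] using hD
    · simp
  | pop _ e top htop =>
    obtain ⟨u, v, L, H, hS, hD, hhS, hE, hhE⟩ := hI
    refine ⟨u, v, L, H.congr ?_ rfl ?_ rfl, ?_, ?_, ?_, hE.congr ?_, hhE⟩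
    · simp
    · simp
    · simpa using hS
    · rwa [htop] at hD
    · simp [hhS, HeadMove.apply]
    · simp
  | load _ e top hb =>
    obtain ⟨u, v, L, H, hS, hD, hhS, hE, hhE⟩ := hI
    beta_reduce at hb
    rw [hhS] at hb
    cases L with
    | nil => rw [List.length_nil, hS] at hb; cases hb
    | cons b L =>
      rw [List.length_cons, hS.1] at hb
      cases hb
      refine ⟨u, v, L, H.congr ?_ rfl ?_ rfl, ?_, ?_, hhS, hE.congr ?_, hhE⟩
      · simp
      · simp
      · simpa using hS.2
      · simpa [sententialForm] using hD
      · simp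
  | done _ hb =>
    obtain ⟨u, v, L, H, hS, hD, hhS, hE, hhE⟩ := hI
    beta_reduce at hb
    rw [hhS] at hb
    cases L with
    | nil =>
      refine ⟨u, v, H.congr ?_ rfl ?_ rfl, ?_, hE.congr ?_, hhE⟩
      · simp
      · simp
      -- With no frames left, the sentential form is the derived terminal word.
      · rw [mem_language_iff]
        simpa [sententialForm, derivedWord] using hD
      · simp
    | cons b L =>
      rw [List.length_cons, hS.1] at hb
      cases hb
  | carry _ m hb =>
    rcases m with top | σ
    · obtain ⟨u, v, x, L, H, hS, hD, hhS, hT⟩ := hI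
      refine ⟨u, v, x, L, H.congr ?_ rfl ?_ rfl, ?_, hD, hhS, ?_⟩
      · simp [CountMode.tape]
      · simp [CountMode.tape]
      · simpa [CountMode.tape] using hS
      · simpa [CountMode.tape, HeadMove.apply] using hT.carry bit_injective bit_ne hb
    · exact hI.elim
  | finish _ m hb =>
    rcases m with top | σ
    · obtain ⟨u, v, x, L, H, hS, hD, hhS, hT⟩ := hI
      have hfin := hT.finish bit_injective bit_ne hb
      refine ⟨u, v ++ [x], L, H.congr ?_ rfl ?_ rfl, ?_, hD, hhS, ?_, ?_⟩
      · simp [CountMode.tape]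
      · simp [CountMode.tape]
      · simpa [CountMode.tape] using hS
      · simpa [CountMode.tape, countWord_append] using hfin.1
      · simpa [countWord_append, Nat.add_comm] using hfin.2
    · exact hI.elim
  | back _ m b hb =>
    rcases m with top | σ
    · obtain ⟨u, v, L, H, hS, hD, hhS, hE⟩ := hI
      refine ⟨u, v, L, H.congr ?_ rfl ?_ rfl, ?_, hD, hhS, hE.congr ?_⟩
      · simp
      · simp
      · simpa using hS
      · simp
    · exact hI.elim
  | resume _ m hb =>
    rcases m with top | σ
    · obtain ⟨u, v, L, H, hS, hD, hhS, hE⟩ := hI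
      simp only [CountMode.tape, hE.1] at hb
      have h0 := eq_zero_of_bitTape_eq_endL hb
      refine ⟨u, v, L, H.congr ?_ rfl ?_ rfl, ?_, hD, hhS, hE.congr ?_, ?_⟩
      · simp
      · simp
      · simpa using hS
      · simp
      · simp [CountMode.tape, h0, HeadMove.apply]
    · exact hI.elim
  | go => exact absurd rfl hq
  | count => exact hI.elim
  | countDone => exact hI.elim
  | check => exact hI.elim
  | accept => exact hI.elim

/-- Reachability without passing through a comparison state. -/
abbrev BeforeCompare (c c' : (g.toLBA B).Config) : Prop :=
  c.state ∉ ({LBAState.compare} : Set (g.LBAState B)) ∧ (g.toLBA B).Step c c'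

theorem derivationInvariant_of_reachable {w : List IsingSymbol} {c : (g.toLBA B).Config}
    (hc : Relation.ReflTransGen BeforeCompare ((g.toLBA B).init w) c) :
    DerivationInvariant w c.state c.tape c.head := by
  induction hc with
  | refl => exact ⟨rfl, rfl⟩
  | tail _ hs ih => exact ih.step hs.1 hs.2

end ContextFreeGrammar


namespace ContextFreeGrammar

open Function (update)
open Relation (ReflTransGen)

variable {g : ContextFreeGrammar IsingSymbol} {B : ℕ}

/-! ### The comparison is sound -/

/-- The counter tape holds the count of `v`. -/
def CounterTape (w v : List IsingSymbol) (t : LBATape → ℕ → g.TapeSymbol B) : Prop :=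
  t .counter = (g.toLBA B).tapeOf w.length ((countWord v).map .bit) ∧
    (countWord v).length ≤ w.length

theorem CounterTape.congr {w v : List IsingSymbol} {t t' : LBATape → ℕ → g.TapeSymbol B}
    (H : CounterTape w v t) (h : t' .counter = t .counter) : CounterTape w v t' := ⟨h ▸ H.1, H.2⟩

/-- All letters of `v` have the sign `σ`, which is unknown only for the empty word. -/
def HasSign (σ : Option Bool) (v : List IsingSymbol) : Prop :=
  v = List.replicate v.length (if σ = some true then .minus else .plus) ∧ (σ = none → v = [])

theorem HasSign.append {σ : Option Bool} {v : List IsingSymbol} (H : HasSign σ v)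
    {x : IsingSymbol} (hx : x = .plus ∨ x = .minus) (hσ : σ = none ∨ σ = some (signBit x)) :
    HasSign (some (signBit x)) (v ++ [x]) := by
  refine ⟨?_, by simp⟩
  have hx' : (if some (signBit x) = some true then IsingSymbol.minus else .plus) = x := by
    rcases hx with rfl | rfl <;> simp [signBit]
  rw [hx']
  rcases hσ with rfl | rfl
  · simp [H.2 rfl]
  · have h := H.1
    rw [hx'] at h
    rw [List.length_append, List.length_singleton, List.replicate_succ', ← h]

/-- This is the syntax check of the remaining input: having letters of one sign only makes it an
actual unary encoding. -/
theorem HasSign.exists_eq {σ : Option Bool} {v : List IsingSymbol} (H : HasSign σ v) :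
    ∃ z, v = energyWord z := by
  by_cases hσ : σ = some true
  · rcases Nat.eq_zero_or_pos v.length with h0 | h0
    · exact ⟨0, by simpa [energyWord, unary] using h0⟩
    · refine ⟨-(v.length : ℤ), ?_⟩
      have h := H.1
      rw [if_pos hσ] at h
      rw [energyWord, unary, if_neg (by omega)]
      simpa using h
  · refine ⟨v.length, ?_⟩
    have h := H.1
    rw [if_neg hσ] at h
    rw [energyWord, unary, if_pos (by omega)]
    simpa using h

/-- The invariant of the comparison of the number `z` on the energy tape with the remaining input
`s`, after the part `u •` of the input. -/
def ComparisonInvariant (w u s : List IsingSymbol) (z : ℤ) :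
    g.LBAState B → (LBATape → ℕ → g.TapeSymbol B) → (LBATape → ℕ) → Prop
  | .compare, t, h => h .input = u.length + 1 ∧ h .energy = 1 ∧ CounterTape w [] t ∧
      h .counter = 1
  | .rest σ, t, h => ∃ v r, s = v ++ r ∧ h .input = (u ++ .sep :: v).length + 1 ∧ HasSign σ v ∧
      h .energy = 1 ∧ CounterTape w v t ∧ h .counter = 1
  | .inc (.inr σ), t, h => ∃ v x r, s = v ++ [x] ++ r ∧
      h .input = (u ++ .sep :: (v ++ [x])).length + 1 ∧ HasSign σ (v ++ [x]) ∧ h .energy = 1 ∧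
      (g.toLBA B).IncrementTape TapeSymbol.bit w.length (signBit x) v.length (t .counter)
        (h .counter)
  | .ret (.inr σ), t, h => ∃ v r, s = v ++ r ∧ h .input = (u ++ .sep :: v).length + 1 ∧
      HasSign σ v ∧ h .energy = 1 ∧ CounterTape w v t
  | .check, t, h => ∃ σ, HasSign σ s ∧ CounterTape w s t ∧ ∃ j, h .energy = j + 1 ∧
      h .counter = j + 1 ∧ ∀ i < j, t .energy (i + 1) = t .counter (i + 1)
  | .final, _, _ => s = energyWord z
  | _, _, _ => False

/-- The remaining input `s` is arbitrary here, since soundness also has to reject words that are not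
well-formed; the letters are checked for a consistent sign while they are counted. Input and energy
tape stay unchanged throughout. -/
theorem ComparisonInvariant.step {w u s : List IsingSymbol} (hw : w = u ++ .sep :: s) {z : ℤ}
    (hz : (binary z).length ≤ w.length) {q q' : g.LBAState B}
    {t t' : LBATape → ℕ → g.TapeSymbol B} {h h' : LBATape → ℕ}
    (hin : t .input = (g.toLBA B).tapeOf w.length (w.map .letter))
    (hen : t .energy = (g.toLBA B).tapeOf w.length ((binary z).map .bit))
    (hI : ComparisonInvariant w u s z q t h) (hs : (g.toLBA B).Step ⟨q, t, h⟩ ⟨q', t', h'⟩) :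
    t' .input = t .input ∧ t' .energy = t .energy ∧ ComparisonInvariant w u s z q' t' h' := by
  obtain ⟨b, d, ⟨htr, -, -⟩, rfl, rfl⟩ := toLBA_step_iff.1 hs
  cases htr with
  | carry _ m hb =>
    rcases m with top | σ
    · exact hI.elim
    · obtain ⟨v, x, r, hs, hhI, hσ, hhE, hT⟩ := hI
      refine ⟨by simp [CountMode.tape], by simp [CountMode.tape], v, x, r, hs, hhI, hσ, hhE, ?_⟩
      simpa [CountMode.tape, HeadMove.apply] using hT.carry bit_injective bit_ne hb
  | finish _ m hb =>
    rcases m with top | σ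
    · exact hI.elim
    · obtain ⟨v, x, r, hs, hhI, hσ, hhE, hT⟩ := hI
      have hfin := hT.finish bit_injective bit_ne hb
      refine ⟨by simp [CountMode.tape], by simp [CountMode.tape], v ++ [x], r, hs, hhI, hσ, hhE,
        ?_, ?_⟩
      · simpa [CountMode.tape, countWord_append] using hfin.1
      · simpa [countWord_append, Nat.add_comm] using hfin.2
  | back _ m b hb =>
    rcases m with top | σ
    · exact hI.elim
    · obtain ⟨v, r, hs, hhI, hσ, hhE, hK⟩ := hI
      exact ⟨by simp, by simp, v, r, hs, hhI, hσ, hhE, hK.congr (by simp)⟩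
  | resume _ m hb =>
    rcases m with top | σ
    · exact hI.elim
    · obtain ⟨v, r, hs, hhI, hσ, hhE, hK⟩ := hI
      simp only [CountMode.tape, hK.1] at hb
      have h0 := eq_zero_of_bitTape_eq_endL hb
      exact ⟨by simp, by simp, v, r, hs, hhI, hσ, hhE, hK.congr (by simp),
        by simp [CountMode.tape, h0, HeadMove.apply]⟩
  | go =>
    obtain ⟨hhI, hhE, hK, hhK⟩ := hI
    exact ⟨by simp, by simp, [], s, rfl, by simp [hhI, HeadMove.apply], ⟨by simp, by simp⟩, hhE,
      hK.congr (by simp), hhK⟩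
  | count _ σ x hx hx' hσ =>
    obtain ⟨v, r, rfl, hhI, hσv, hhE, hK, hhK⟩ := hI
    beta_reduce at hx
    rw [hin, hhI] at hx
    obtain ⟨r, rfl⟩ := exists_cons_of_input_symbol (r := r) (by simp [hw]) hx
    refine ⟨by simp, by simp, v, x, r, by simp, ?_, hσv.append hx' hσ, hhE, ?_⟩
    · simp [hhI, HeadMove.apply]; omega
    · have hl := hK.2
      rw [length_countWord] at hl
      simpa [hhK, HeadMove.apply, hK.1, countWord] using
        LinearBoundedAutomaton.IncrementTape.init (A := g.toLBA B) (bit := TapeSymbol.bit)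
          (σ := signBit x) (σ' := (v.getLast?.map signBit).getD false) hl
  | countDone _ σ hx =>
    obtain ⟨v, r, rfl, hhI, hσv, hhE, hK, hhK⟩ := hI
    beta_reduce at hx
    rw [hin, hhI] at hx
    obtain rfl := eq_nil_of_input_symbol (r := r) (by simp [hw]) hx
    rw [List.append_nil]
    exact ⟨by simp, by simp, σ, hσv, hK.congr (by simp), 0, hhE, hhK, by simp⟩
  | check _ hEK =>
    obtain ⟨σ, hσ, hK, j, hhE, hhK, hj⟩ := hI
    beta_reduce at hEK
    rw [hhE, hhK] at hEK
    refine ⟨by simp, by simp, σ, hσ, hK.congr (by simp), j + 1, by simp [hhE, HeadMove.apply],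
      by simp [hhK, HeadMove.apply], fun i hi => ?_⟩
    simp only [Function.update_eq_self]
    rcases Nat.lt_succ_iff_lt_or_eq.1 hi with hi | rfl
    · exact hj i hi
    · exact hEK
  | accept _ hE hK' =>
    obtain ⟨σ, hσ, hK, j, hhE, hhK, hj⟩ := hI
    refine ⟨by simp, by simp, ?_⟩
    beta_reduce at hE
    rw [hhE, hen] at hE
    -- The right endmarker can only be read after all usable cells have been compared.
    have hjN : w.length ≤ j := by
      by_contra hjN
      exact LinearBoundedAutomaton.tapeOf_ne_endR (g.toLBA B)
        (by simp +contextual [or_imp, eq_comm]) (by omega) hE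
    have hbin := LinearBoundedAutomaton.tapeOf_inj (g.toLBA B) (w := (binary z).map .bit)
      (w' := (countWord s).map .bit) (by simp +contextual [or_imp, eq_comm])
      (by simp +contextual [or_imp, eq_comm]) (by simpa using hz) (by simpa using hK.2)
      (fun i hi => by rw [← hen, ← hK.1]; exact hj i (by omega))
    obtain ⟨z', rfl⟩ := hσ.exists_eq
    have := List.map_injective_iff.2 bit_injective hbin
    rw [countWord_energyWord] at this
    rw [ComparisonInvariant, binary_injective this]
  | _ => exact hI.elim

theorem eq_energyWord_of_acceptsFrom {w u s : List IsingSymbol} (hw : w = u ++ .sep :: s) {z : ℤ}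
    (hz : (binary z).length ≤ w.length) {t : LBATape → ℕ → g.TapeSymbol B} {h : LBATape → ℕ}
    (hin : t .input = (g.toLBA B).tapeOf w.length (w.map .letter))
    (hen : t .energy = (g.toLBA B).tapeOf w.length ((binary z).map .bit))
    (hI : ComparisonInvariant w u s z .compare t h)
    (hacc : (g.toLBA B).AcceptsFrom ⟨.compare, t, h⟩) : s = energyWord z := by
  obtain ⟨⟨q', t', h'⟩, hd, ha, -⟩ := hacc
  obtain rfl : q' = .final := ha
  suffices H : ∀ c : (g.toLBA B).Config, ReflTransGen (g.toLBA B).Step ⟨.compare, t, h⟩ c →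
      c.tape .input = t .input ∧ c.tape .energy = t .energy ∧
        ComparisonInvariant w u s z c.state c.tape c.head from (H _ hd).2.2
  intro c hc
  induction hc with
  | refl => exact ⟨rfl, rfl, hI⟩
  | tail _ hs ih =>
    obtain ⟨h1, h2, h3⟩ := ih
    obtain ⟨h4, h5, h6⟩ := h3.step hw hz (h1.trans hin) (h2.trans hen) hs
    exact ⟨h4.trans h1, h5.trans h2, h6⟩

/-! ### Computations of the automaton -/

/-- For transitions that act on a single tape, the endmarker conditions need checking there only:
the other tapes are rewritten with what they hold, and their heads stay. -/
theorem toLBA_step_write {q q' : g.LBAState B} {t : LBATape → ℕ → g.TapeSymbol B}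
    {h : LBATape → ℕ} {i : LBATape} {x : g.TapeSymbol B} {d : HeadMove}
    (htr : g.LBATrans B q (fun j => t j (h j)) q' (update (fun j => t j (h j)) i x)
      (update noMove i d))
    (hL : t i (h i) = .endL → x = .endL ∧ d ≠ .left)
    (hR : t i (h i) = .endR → x = .endR ∧ d ≠ .right) :
    (g.toLBA B).Step ⟨q, t, h⟩
      ⟨q', update t i (update (t i) (h i) x), update h i (d.apply (h i))⟩ := by
  refine toLBA_step_iff.2 ⟨_, _, ⟨htr, fun j hj => ?_, fun j hj => ?_⟩, ?_, ?_⟩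
  · rcases eq_or_ne j i with rfl | hij
    · simpa using hL hj
    · simpa [hij, noMove] using hj
  · rcases eq_or_ne j i with rfl | hij
    · simpa using hR hj
    · simpa [hij, noMove] using hj
  · funext j
    rcases eq_or_ne j i with rfl | hij <;> simp [*]
  · funext j
    rcases eq_or_ne j i with rfl | hij <;> simp [*, noMove, HeadMove.apply]

theorem toLBA_step_move {q q' : g.LBAState B} {t : LBATape → ℕ → g.TapeSymbol B}
    {h : LBATape → ℕ} {i : LBATape} {d : HeadMove}
    (htr : g.LBATrans B q (fun j => t j (h j)) q' (fun j => t j (h j)) (update noMove i d))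
    (hL : t i (h i) = .endL → d ≠ .left) (hR : t i (h i) = .endR → d ≠ .right) :
    (g.toLBA B).Step ⟨q, t, h⟩ ⟨q', t, update h i (d.apply (h i))⟩ := by
  have := toLBA_step_write (i := i) (x := t i (h i)) (d := d)
    (by simpa only [Function.update_eq_self] using htr) (fun h' => ⟨h', hL h'⟩)
    (fun h' => ⟨h', hR h'⟩)
  simpa only [Function.update_eq_self] using this

theorem toLBA_step_stay {q q' : g.LBAState B} {t : LBATape → ℕ → g.TapeSymbol B}
    {h : LBATape → ℕ} (htr : g.LBATrans B q (fun j => t j (h j)) q' (fun j => t j (h j)) noMove) :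
    (g.toLBA B).Step ⟨q, t, h⟩ ⟨q', t, h⟩ := by
  have := toLBA_step_move (i := .input) (d := .stay)
    (by rwa [show HeadMove.stay = noMove .input from rfl, Function.update_eq_self])
    (by simp) (by simp)
  simpa [HeadMove.apply] using this

theorem ret_run {m : g.CountMode B} {t : LBATape → ℕ → g.TapeSymbol B} {h : LBATape → ℕ}
    {N : ℕ} {l : List Bool} (ht : t m.tape = (g.toLBA B).tapeOf N (l.map .bit))
    (hl : l.length ≤ N) (hh : h m.tape ≤ l.length) :
    ReflTransGen BeforeCompare ⟨.ret m, t, h⟩ ⟨m.resume, t, update h m.tape 1⟩ := by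
  generalize hn : h m.tape = n at hh
  induction n generalizing h with
  | zero =>
    refine .single ⟨by simp, ?_⟩
    have h0 : t m.tape (h m.tape) = .endL := by rw [hn, ht]; rfl
    have := toLBA_step_move (h := h) (t := t) (.resume _ m h0) (by simp) (by simp [h0])
    simpa [hn, HeadMove.apply] using this
  | succ n ih =>
    have h0 : t m.tape (h m.tape) = .bit l[n] := by
      rw [hn, ht, LinearBoundedAutomaton.tapeOf_succ_of_lt _ _ (by omega)]
      simp [List.getD_eq_getElem?_getD, show n < l.length by omega]
    refine .head ⟨by simp, toLBA_step_move (.back _ m _ h0) (by simp [h0]) (by simp)⟩ ?_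
    have := ih (h := update h m.tape (HeadMove.left.apply (h m.tape)))
      (by simp [hn, HeadMove.apply]) (by omega)
    simpa using this

theorem inc_run {m : g.CountMode B} {t : LBATape → ℕ → g.TapeSymbol B} {h : LBATape → ℕ}
    {N k : ℕ} {σ : Bool} (ht : (g.toLBA B).IncrementTape TapeSymbol.bit N σ k (t m.tape) (h m.tape))
    (hN : 1 + (k + 1).bits.length ≤ N) :
    ReflTransGen BeforeCompare ⟨.inc m, t, h⟩ ⟨m.resume, update t m.tape
      ((g.toLBA B).tapeOf N ((σ :: (k + 1).bits).map .bit)), update h m.tape 1⟩ := by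
  have hle : ∀ {t : ℕ → g.TapeSymbol B} {i : ℕ},
      (g.toLBA B).IncrementTape TapeSymbol.bit N σ k t i → 1 ≤ i ∧ i ≤ k.bits.length + 2 := by
    rintro t i ⟨j, r, -, rfl, hk, -⟩
    rw [hk]; simp
  -- The head cannot get beyond the first cell after the digits, so its distance from that cell
  -- decreases with every carry.
  generalize hn : k.bits.length + 2 - h m.tape = n
  induction n using Nat.strong_induction_on generalizing t h with
  | _ n ih =>
    rcases ht.symbol hN with h0 | h0
    · have h1 := (hle ht).2
      have hc := ht.carry bit_injective bit_ne h0
      have h2 := (hle hc).2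
      have hs := toLBA_step_write (h := h) (t := t) (.carry _ m h0)
        (by simp [h0]) (by simp [h0])
      refine .head ⟨by simp, hs⟩ ?_
      have := ih (k.bits.length + 2 - (h m.tape + 1)) (by omega)
        (t := update t m.tape (update (t m.tape) (h m.tape) (.bit false)))
        (h := update h m.tape (HeadMove.right.apply (h m.tape)))
        (by simpa [HeadMove.apply] using hc) (by simp [HeadMove.apply])
      simpa using this
    · have hs := toLBA_step_write (h := h) (t := t) (.finish _ m h0)
        (by rcases h0 with h0 | h0 <;> simp [h0]) (by rcases h0 with h0 | h0 <;> simp [h0])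
      refine .head ⟨by simp, hs⟩ ?_
      have h1 := hle ht
      have h2 := bits_length_mono (Nat.le_succ k)
      have hf := (ht.finish bit_injective bit_ne h0).1
      have := ret_run (m := m) (N := N) (l := σ :: (k + 1).bits)
        (t := update t m.tape (update (t m.tape) (h m.tape) (.bit true)))
        (h := update h m.tape (HeadMove.left.apply (h m.tape)))
        (by simpa using hf) (by simp; omega)
        (by simp [HeadMove.apply] at h2 ⊢; omega)
      simpa [hf] using this

end ContextFreeGrammar


namespace ContextFreeGrammar

open Function (update)
open Relation (ReflTransGen)

variable {g : ContextFreeGrammar IsingSymbol} {B : ℕ}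

/-! ### The comparison is complete -/

theorem toLBA_step {q q' : g.LBAState B} {t : LBATape → ℕ → g.TapeSymbol B} {h : LBATape → ℕ}
    {b : LBATape → g.TapeSymbol B} {d : LBATape → HeadMove}
    (htr : g.LBATrans B q (fun i => t i (h i)) q' b d)
    (hL : ∀ i, t i (h i) = .endL → b i = .endL ∧ d i ≠ .left)
    (hR : ∀ i, t i (h i) = .endR → b i = .endR ∧ d i ≠ .right) :
    (g.toLBA B).Step ⟨q, t, h⟩
      ⟨q', fun i => update (t i) (h i) (b i), fun i => (d i).apply (h i)⟩ :=
  toLBA_step_iff.2 ⟨b, d, ⟨htr, hL, hR⟩, rfl, rfl⟩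

theorem toLBA_acceptsFrom_final {t : LBATape → ℕ → g.TapeSymbol B} {h : LBATape → ℕ} :
    (g.toLBA B).AcceptsFrom ⟨.final, t, h⟩ := by
  refine ⟨_, .refl, rfl, ?_⟩
  rintro d ⟨b, d, ⟨htr, -⟩, -⟩
  cases htr

theorem toLBA_acceptsFrom_of_reachable {c d : (g.toLBA B).Config}
    (h : ReflTransGen (g.toLBA B).Step c d) (hd : (g.toLBA B).AcceptsFrom d) :
    (g.toLBA B).AcceptsFrom c :=
  let ⟨e, he, ha⟩ := hd
  ⟨e, h.trans he, ha⟩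

theorem reachable_of_beforeCompare {c d : (g.toLBA B).Config}
    (h : ReflTransGen BeforeCompare c d) : ReflTransGen (g.toLBA B).Step c d :=
  ReflTransGen.mono (fun _ _ h => h.2) _ _ h

theorem acceptsFrom_check {N : ℕ} {l : List Bool} {t : LBATape → ℕ → g.TapeSymbol B}
    {h : LBATape → ℕ} {j : ℕ} (hE : t .energy = (g.toLBA B).tapeOf N (l.map .bit))
    (hK : t .counter = t .energy) (hhE : h .energy = j + 1) (hhK : h .counter = j + 1)
    (hj : j ≤ N) : (g.toLBA B).AcceptsFrom ⟨.check, t, h⟩ := by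
  generalize hn : N - j = n
  induction n generalizing j h with
  | zero =>
    obtain rfl : j = N := by omega
    have h1 : t .energy (h .energy) = .endR := by
      rw [hhE, hE]; exact LinearBoundedAutomaton.tapeOf_last _ _ _
    have h2 : t .counter (h .counter) = .endR := by rw [hK, hhK, ← hhE, h1]
    exact toLBA_acceptsFrom_of_reachable (.single (toLBA_step_stay (.accept _ h1 h2)))
      toLBA_acceptsFrom_final
  | succ n ih =>
    -- Both heads are still on usable cells, so moving right is permitted.
    have hR : t .energy (j + 1) ≠ .endR := by
      rw [hE]
      exact LinearBoundedAutomaton.tapeOf_ne_endR _ (by simp +contextual [or_imp, eq_comm])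
        (by omega)
    have hs := toLBA_step (t := t) (h := h) (.check _ (by rw [hhE, hhK, hK]))
      (fun i hi => ⟨hi, by rcases i with _ | _ | _ | _ <;> simp [noMove]⟩)
      (fun i hi => ⟨hi, by
        rcases i with _ | _ | _ | _
        · simp [noMove]
        · rw [hhE] at hi; exact absurd hi hR
        · rw [hhK, hK] at hi; exact absurd hi hR
        · simp [noMove]⟩)
    simp only [Function.update_eq_self] at hs
    exact toLBA_acceptsFrom_of_reachable (.single hs)
      (ih (j := j + 1) (by simp [hhE, HeadMove.apply]) (by simp [hhK, HeadMove.apply]) (by omega)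
        (by omega))

theorem signBit_of_mem_energyWord {x : IsingSymbol} {z : ℤ} (hx : x ∈ energyWord z) :
    signBit x = decide (z < 0) := by
  unfold energyWord unary at hx
  split at hx
  · rw [List.eq_of_mem_replicate hx]; simp [signBit]; omega
  · rw [List.eq_of_mem_replicate hx]; simp [signBit]; omega

theorem acceptsFrom_rest {w u v r : List IsingSymbol} {z : ℤ} {σ : Option Bool}
    (hw : w = u ++ .sep :: energyWord z) (hr : energyWord z = v ++ r)
    (hz : (binary z).length ≤ w.length) {t : LBATape → ℕ → g.TapeSymbol B} {h : LBATape → ℕ}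
    (hin : t .input = (g.toLBA B).tapeOf w.length (w.map .letter))
    (hen : t .energy = (g.toLBA B).tapeOf w.length ((binary z).map .bit))
    (hhI : h .input = (u ++ .sep :: v).length + 1) (hσ : σ = none ∨ σ = some (decide (z < 0)))
    (hhE : h .energy = 1) (hK : CounterTape w v t) (hhK : h .counter = 1) :
    (g.toLBA B).AcceptsFrom ⟨.rest σ, t, h⟩ := by
  induction r generalizing v σ t h with
  | nil =>
    rw [List.append_nil] at hr
    subst hr
    have hx : t .input (h .input) = .endR := by
      rw [hin, hhI, hw]; exact input_symbol_nil
    refine toLBA_acceptsFrom_of_reachable (.single (toLBA_step_stay (.countDone _ σ hx)))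
      (acceptsFrom_check (j := 0) hen ?_ hhE hhK (Nat.zero_le _))
    rw [hK.1, hen, countWord_energyWord]
  | cons x r ih =>
    have hmem : x ∈ energyWord z := by rw [hr]; simp
    have hx : t .input (h .input) = .letter x := by
      rw [hin, hhI, hw, hr, show u ++ IsingSymbol.sep :: (v ++ x :: r) =
        (u ++ .sep :: v) ++ x :: r by simp]
      exact input_symbol
    -- A partial count has at most as many digits as the final one, which fits by `hz`.
    have hlen : (countWord (v ++ [x])).length ≤ w.length := by
      refine le_trans ?_ hz
      rw [← countWord_energyWord, length_countWord, length_countWord, hr]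
      exact Nat.add_le_add_left (bits_length_mono (by simp)) 1
    have hKs : ∃ b, t .counter (h .counter) = .bit b := by
      refine ⟨(v.getLast?.map signBit).getD false, ?_⟩
      rw [hhK, hK.1, LinearBoundedAutomaton.tapeOf_succ_of_lt _ _ (by rw [hw]; simp)]
      simp only [countWord, List.map_cons, List.getD_cons_zero]
    obtain ⟨b, hb⟩ := hKs
    have hs := toLBA_step (t := t) (h := h)
      (.count _ σ x hx (mem_energyWord hmem) (by rwa [signBit_of_mem_energyWord hmem]))
      (fun i hi => by
        rcases i with _ | _ | _ | _
        · rw [hx] at hi; cases hi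
        · exact ⟨by simpa using hi, by simp [noMove]⟩
        · rw [hb] at hi; cases hi
        · exact ⟨by simpa using hi, by simp [noMove]⟩)
      (fun i hi => by
        rcases i with _ | _ | _ | _
        · rw [hx] at hi; cases hi
        · exact ⟨by simpa using hi, by simp [noMove]⟩
        · rw [hb] at hi; cases hi
        · exact ⟨by simpa using hi, by simp [noMove]⟩)
    refine toLBA_acceptsFrom_of_reachable (.single hs) ?_
    have hl := hK.2
    rw [length_countWord] at hl
    rw [countWord_append, List.length_cons, Nat.add_comm] at hlen
    refine toLBA_acceptsFrom_of_reachable (reachable_of_beforeCompare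
      (inc_run (N := w.length) (k := v.length) (σ := signBit x) ?_ hlen)) ?_
    · simpa [CountMode.tape, hhK, HeadMove.apply, hK.1, countWord] using
        LinearBoundedAutomaton.IncrementTape.init (A := g.toLBA B) (bit := TapeSymbol.bit)
          (σ := signBit x) (σ' := (v.getLast?.map signBit).getD false) hl
    · refine ih (v := v ++ [x]) (by simp [hr]) ?_ ?_ ?_ ?_ ?_ ⟨?_, ?_⟩ ?_
      · simpa [CountMode.tape] using hin
      · simpa [CountMode.tape] using hen
      · simp [CountMode.tape, hhI, HeadMove.apply]; omega
      · rw [signBit_of_mem_energyWord hmem]; exact Or.inr rfl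
      · simp [CountMode.tape, hhE, noMove, HeadMove.apply]
      · simp [CountMode.tape, countWord_append]
      · rw [countWord_append, List.length_cons, Nat.add_comm]; exact hlen
      · simp [CountMode.tape]

theorem acceptsFrom_compare {w u s : List IsingSymbol} {z : ℤ}
    (hw : w = u ++ .sep :: s) (hz : (binary z).length ≤ w.length)
    {t : LBATape → ℕ → g.TapeSymbol B} {h : LBATape → ℕ}
    (hin : t .input = (g.toLBA B).tapeOf w.length (w.map .letter))
    (hen : t .energy = (g.toLBA B).tapeOf w.length ((binary z).map .bit))
    (hI : ComparisonInvariant w u s z .compare t h) :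
    (g.toLBA B).AcceptsFrom ⟨.compare, t, h⟩ ↔ s = energyWord z := by
  refine ⟨eq_energyWord_of_acceptsFrom hw hz hin hen hI, ?_⟩
  rintro rfl
  obtain ⟨hhI, hhE, hK, hhK⟩ := hI
  have hx : t .input (h .input) = .letter .sep := by
    rw [hin, hhI, hw]; exact input_symbol
  -- The input head was left on the separator, so the first step moves it to the energy.
  refine toLBA_acceptsFrom_of_reachable (.single (toLBA_step_move (.go _) (by simp)
    (by simp [hx]))) (acceptsFrom_rest (v := []) hw rfl hz hin hen ?_ (Or.inl rfl) ?_ hK ?_)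
  · simp [hhI, HeadMove.apply]
  · simpa using hhE
  · simpa using hhK

end ContextFreeGrammar


namespace ContextFreeGrammar

open Function (update)
open Relation (ReflTransGen)

variable {g : ContextFreeGrammar IsingSymbol} {B : ℕ}

/-! ### Words of the language can be derived within the available space -/

/-- The configuration `⟨.main top e, t, h⟩` represents the stack `fs`, with the topmost frames in
`top` and the others in full blocks `L` on the stack tape. -/
structure RepresentsStack (w u v : List IsingSymbol) (e : Bool) (top : g.Block B)
    (L : List (g.Block B)) (fs : List g.Frame) (t : LBATape → ℕ → g.TapeSymbol B)
    (h : LBATape → ℕ) : Prop where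
  phase : DerivationPhase w u v e t h
  stack : StackTape L (t .stack)
  full : ∀ b ∈ L, b.1.length = B
  head_stack : h .stack = L.length + 1
  energy : EnergyTape w v t
  head_energy : h .energy = 1
  frames : fs = top.1 ++ L.flatMap (·.1)
  ne_endL : ∀ i, t .stack (i + 1) ≠ .endL
  ne_endR : ∀ i < w.length, t .stack (i + 1) ≠ .endR

/-- The automaton has derived the word `x` and has the frames `fs` left. -/
def Represents (w x : List IsingSymbol) (fs : List g.Frame) (c : (g.toLBA B).Config) : Prop :=
  ∃ e u v top L t h, x = derivedWord e u v ∧ c = ⟨.main top e, t, h⟩ ∧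
    RepresentsStack w u v e top L fs t h

/-- An exhausted top block is replaced by the next one from the tape. One reload suffices, as blocks
on the tape are full and `B` is positive. -/
theorem RepresentsStack.exists_top {w u v : List IsingSymbol} {e : Bool} {top : g.Block B}
    {L : List (g.Block B)} {f : g.Frame} {fs : List g.Frame} {t : LBATape → ℕ → g.TapeSymbol B}
    {h : LBATape → ℕ} (hB : 0 < B) (H : RepresentsStack w u v e top L (f :: fs) t h) :
    ∃ top' L' gs h', ReflTransGen BeforeCompare ⟨.main top e, t, h⟩ ⟨.main top' e, t, h'⟩ ∧
      RepresentsStack w u v e top' L' (f :: fs) t h' ∧ top'.1 = f :: gs := by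
  rcases htop : top.1 with _ | ⟨f', gs⟩
  · rcases L with _ | ⟨b, L⟩
    · have := H.frames
      simp [htop] at this
    · have hb : b.1.length = B := H.full b (by simp)
      have hfr := H.frames
      rw [htop, List.nil_append, List.flatMap_cons] at hfr
      rcases hb' : b.1 with _ | ⟨f', gs⟩
      · simp [hb'] at hb; omega
      · have hf : f = f' := by rw [hb'] at hfr; simpa using (List.cons_eq_cons.1 hfr).1
        subst hf
        have h1 : t .stack (h .stack) ≠ .endL := by rw [H.head_stack]; exact H.ne_endL _
        have hh : HeadMove.left.apply (h .stack) = L.length + 1 := by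
          simp [H.head_stack, HeadMove.apply]
        refine ⟨b, L, gs, update h .stack (HeadMove.left.apply (h .stack)),
          .head ⟨by simp, toLBA_step_move (.pop _ e top htop) (fun h' => absurd h' h1) (by simp)⟩
            (.single ⟨by simp, toLBA_step_stay (.load _ e b ?_)⟩), ?_, hb'⟩
        · simp only [Function.update_self, hh]; exact H.stack.1
        · exact ⟨H.phase.congr rfl (by simp) rfl (by simp), H.stack.2,
            fun b hb => H.full b (by simp [hb]), by simpa using hh, H.energy,
            by simpa using H.head_energy, hfr, H.ne_endL, H.ne_endR⟩
  · have hf : f = f' := by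
      have := H.frames
      rw [htop] at this
      exact (List.cons_eq_cons.1 this).1
    subst hf
    exact ⟨top, L, gs, h, .refl, H, htop⟩

theorem RepresentsStack.eq_append {w u v : List IsingSymbol} {e : Bool} {top : g.Block B}
    {L : List (g.Block B)} {f : g.Frame} {fs gs : List g.Frame}
    {t : LBATape → ℕ → g.TapeSymbol B} {h : LBATape → ℕ}
    (H : RepresentsStack w u v e top L (f :: fs) t h) (htop : top.1 = f :: gs) :
    fs = gs ++ L.flatMap (·.1) := by
  have := H.frames
  rw [htop, List.cons_append] at this
  exact (List.cons_eq_cons.1 this).2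

/-- Fullness of the stored blocks converts a bound on the number of frames into a bound on the
number of occupied cells. -/
theorem RepresentsStack.length_eq {w u v : List IsingSymbol} {e : Bool} {top : g.Block B}
    {L : List (g.Block B)} {fs : List g.Frame}
    {t : LBATape → ℕ → g.TapeSymbol B} {h : LBATape → ℕ}
    (H : RepresentsStack w u v e top L fs t h) : fs.length = top.1.length + B * L.length := by
  have hL : ∀ L : List (g.Block B), (∀ b ∈ L, b.1.length = B) →
      (L.flatMap (·.1)).length = B * L.length := by
    intro L hL
    induction L with
    | nil => rfl
    | cons b L ih =>
      rw [List.flatMap_cons, List.length_append, ih fun b hb => hL b (by simp [hb]),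
        hL b (by simp), List.length_cons]
      ring
  rw [H.frames, List.length_append, hL L H.full]

theorem Represents.drop {w x : List IsingSymbol} {f : g.Frame} {fs : List g.Frame}
    {c : (g.toLBA B).Config} (hB : 0 < B) (H : Represents w x (f :: fs) c) (hf : f.1 = []) :
    ∃ c', ReflTransGen BeforeCompare c c' ∧ Represents w x fs c' := by
  obtain ⟨e, u, v, top, L, t, h, rfl, rfl, H⟩ := H
  obtain ⟨top, L, gs, h, hr, H, htop⟩ := H.exists_top hB
  have hle : gs.length ≤ B := by
    have := top.2; rw [htop] at this; simp at this; omega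
  refine ⟨_, hr.tail ⟨by simp, toLBA_step_stay (.drop _ e top ⟨gs, hle⟩ f htop hf)⟩,
    e, u, v, ⟨gs, hle⟩, L, t, h, rfl, rfl, ?_⟩
  exact { H with frames := H.eq_append htop }

/-- The rules permit spilling a block at any time. Here it is done only if the top block is full,
which keeps all stored blocks full. -/
theorem Represents.expand {w x : List IsingSymbol} {f f' fr : g.Frame} {fs : List g.Frame}
    {c : (g.toLBA B).Config} (hB : 0 < B) (H : Represents w x (f :: fs) c)
    {r : ContextFreeRule IsingSymbol g.NT} (hr : r ∈ g.rules)
    (hf : f.1 = .nonterminal r.input :: f'.1) (hfr : fr.1 = r.output)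
    (hN : (f :: fs).length ≤ B * w.length) :
    ∃ c', ReflTransGen BeforeCompare c c' ∧ Represents w x (fr :: f' :: fs) c' := by
  obtain ⟨e, u, v, top, L, t, h, rfl, rfl, H⟩ := H
  obtain ⟨top, L, gs, h, hreach, H, htop⟩ := H.exists_top hB
  have hle := top.2
  rw [htop, List.length_cons] at hle
  rcases Nat.lt_or_ge (gs.length + 1) B with hlt | hge
  · refine ⟨_, hreach.tail ⟨by simp, toLBA_step_stay
      (.expand _ e top ⟨fr :: f' :: gs, by simp; omega⟩ f f' fr gs r hr htop hf hfr rfl)⟩,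
      e, u, v, _, L, t, h, rfl, rfl, ?_⟩
    exact { H with frames := by simp [H.eq_append htop] }
  -- The top block alone accounts for `B` frames, so the bound on the stack leaves a free cell for
  -- it.
  · have hL : L.length + 1 ≤ w.length := by
      rw [H.length_eq, htop, List.length_cons, show gs.length + 1 = B by omega] at hN
      exact Nat.le_of_mul_le_mul_left (by rw [Nat.mul_succ]; omega) hB
    have hs := toLBA_step_write (t := t) (h := h) (.expandSpill _ e top ⟨[fr], hB⟩
      ⟨f' :: gs, by simpa using hle⟩ f f' fr gs r hr htop hf hfr rfl rfl)
      (fun h' => by rw [H.head_stack] at h'; exact absurd h' (H.ne_endL _))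
      (fun h' => by rw [H.head_stack] at h'; exact absurd h' (H.ne_endR _ (by omega)))
    refine ⟨_, hreach.tail ⟨by simp, hs⟩, e, u, v, _, ⟨f' :: gs, by simpa using hle⟩ :: L, _, _,
      rfl, rfl, H.phase.congr (by simp) (by simp) (by simp) (by simp), ⟨?_, ?_⟩, ?_, ?_,
      H.energy.congr (by simp), by simpa using H.head_energy, ?_, fun i => ?_, fun i hi => ?_⟩
    · simp [H.head_stack]
    · simpa using H.stack.update (by rw [H.head_stack]; omega) _
    · intro b hb
      rcases List.mem_cons.1 hb with rfl | hb
      · simp; omega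
      · exact H.full b hb
    · simp [H.head_stack, HeadMove.apply]
    · simp [H.eq_append htop]
    · rw [Function.update_self]
      by_cases hi : i + 1 = h .stack
      · rw [hi, Function.update_self]; simp
      · rw [Function.update_of_ne hi]; exact H.ne_endL i
    · rw [Function.update_self]
      by_cases hi' : i + 1 = h .stack
      · rw [hi', Function.update_self]; simp
      · rw [Function.update_of_ne hi']; exact H.ne_endR i hi

/-- The letter is a spin, the separator, or an energy letter, depending on its place in the target
word `u₀ • v₀`. Only `u₀ •` has to agree with the input; energy letters are merely counted, and `hv`
provides the space. -/
theorem Represents.terminal {w x u₀ v₀ r₀ : List IsingSymbol} {a : IsingSymbol} {f f' : g.Frame}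
    {fs : List g.Frame} {c : (g.toLBA B).Config} (hB : 0 < B) (H : Represents w x (f :: fs) c)
    (hw : w = u₀ ++ .sep :: r₀) (hu : .sep ∉ u₀) (hv : (countWord v₀).length ≤ w.length)
    (hf : f.1 = .terminal a :: f'.1) (hx : x ++ [a] <+: u₀ ++ .sep :: v₀) :
    ∃ c', ReflTransGen BeforeCompare c c' ∧ Represents w (x ++ [a]) (f' :: fs) c' := by
  obtain ⟨e, u, v, top, L, t, h, rfl, rfl, H⟩ := H
  obtain ⟨top, L, gs, h, hreach, H, htop⟩ := H.exists_top hB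
  obtain ⟨y, hy⟩ := hx
  have hle := top.2
  rw [htop] at hle
  have hphase := H.phase
  cases e with
  | false =>
    obtain ⟨rest, hrest, -, hv0⟩ := H.phase.word
    obtain rfl := hv0 rfl
    simp only [derivedWord, Bool.false_eq_true, if_false, List.append_nil, List.append_assoc,
      List.singleton_append] at hy ⊢
    by_cases ha : a = .sep
    · subst ha
      obtain ⟨rfl, rfl⟩ := append_sep_inj H.phase.sep_notMem hu hy
      have hx : t .input (h .input) = .letter .sep := by
        rw [H.phase.input, H.phase.head_input, hw]; exact input_symbol
      refine ⟨_, hreach.tail ⟨by simp, toLBA_step_stay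
        (.sep _ top ⟨f' :: gs, hle⟩ f f' gs htop hf rfl hx)⟩,
        true, u, [], ⟨f' :: gs, hle⟩, L, t, h, by simp [derivedWord], rfl, ?_⟩
      exact { H with
        phase := { H.phase with word := ⟨_, hw, fun _ => ⟨_, rfl⟩, by simp⟩ }
        frames := by simp [H.eq_append htop] }
    -- A letter other than the separator, derived while no separator has occurred, must lie inside
    -- the spin part of the target.
    · obtain ⟨y', rfl⟩ : ∃ y', u₀ = u ++ a :: y' := by
        rcases List.append_eq_append_iff.1 hy with ⟨z, h1, h2⟩ | ⟨z, h1, h2⟩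
        · cases z with
          | nil => exact absurd (List.cons_eq_cons.1 h2).1 ha
          | cons b z =>
            obtain ⟨rfl, -⟩ := List.cons_eq_cons.1 h2
            exact ⟨z, h1⟩
        · cases z with
          | nil => exact absurd (List.cons_eq_cons.1 h2).1.symm ha
          | cons b z =>
            obtain ⟨rfl, -⟩ := List.cons_eq_cons.1 h2
            exact absurd (by simp [h1]) H.phase.sep_notMem
      have hx : t .input (h .input) = .letter a := by
        rw [H.phase.input, H.phase.head_input, hw, List.append_assoc, List.cons_append]
        exact input_symbol
      refine ⟨_, hreach.tail ⟨by simp, toLBA_step_move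
        (.spin _ top ⟨f' :: gs, hle⟩ f f' gs a htop hf rfl hx ha) (by simp) (by simp [hx])⟩,
        false, u ++ [a], [], ⟨f' :: gs, hle⟩, L, t, _, by simp [derivedWord], rfl, ?_⟩
      refine ⟨⟨H.phase.input, ?_, ?_, ⟨y' ++ .sep :: r₀, by simp [hw], by simp, by simp⟩,
        H.phase.counter, by simpa using H.phase.head_counter, H.phase.length_pos⟩, H.stack, H.full,
        by simpa using H.head_stack, H.energy, by simpa using H.head_energy,
        by simp [H.eq_append htop], H.ne_endL, H.ne_endR⟩
      · simp [H.phase.head_input, HeadMove.apply]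
      · simpa [H.phase.sep_notMem] using Ne.symm ha
  | true =>
    obtain ⟨rest, hrest, hsep, -⟩ := H.phase.word
    simp only [derivedWord, if_true, List.append_assoc, List.cons_append] at hy ⊢
    obtain ⟨rfl, rfl⟩ := append_sep_inj H.phase.sep_notMem hu hy
    -- The energy letters derived so far, with the new one, form a prefix of `v₀`.
    have hlen : 1 + (v.length + 1).bits.length ≤ w.length := by
      refine le_trans ?_ hv
      rw [length_countWord]
      exact Nat.add_le_add_left (bits_length_mono (by simp)) 1
    have hl := H.energy.2
    rw [length_countWord] at hl
    have hE : t .energy (h .energy) = .bit ((v.getLast?.map signBit).getD false) := by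
      rw [H.head_energy, H.energy.1, LinearBoundedAutomaton.tapeOf_succ_of_lt _ _
        (by have := H.phase.length_pos; omega)]
      simp only [countWord, List.map_cons, List.getD_cons_zero]
    have hs := toLBA_step_write (t := t) (h := h)
      (.emit _ top ⟨f' :: gs, hle⟩ f f' gs a htop hf rfl) (by simp [hE]) (by simp [hE])
    have hinc := inc_run (m := .inl ⟨f' :: gs, hle⟩) (N := w.length) (k := v.length)
      (σ := signBit a) (t := update t .energy (update (t .energy) (h .energy) (.bit (signBit a))))
      (h := update h .energy (HeadMove.right.apply (h .energy))) (by
        simpa [CountMode.tape, H.head_energy, HeadMove.apply, H.energy.1, countWord] using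
          LinearBoundedAutomaton.IncrementTape.init (A := g.toLBA B) (bit := TapeSymbol.bit)
            (σ := signBit a) (σ' := (v.getLast?.map signBit).getD false) hl) hlen
    refine ⟨_, (hreach.tail ⟨by simp, hs⟩).trans hinc, true, u, v ++ [a], ⟨f' :: gs, hle⟩, L, _, _,
      by simp [derivedWord], rfl, ?_⟩
    refine ⟨⟨?_, ?_, H.phase.sep_notMem, ⟨rest, hrest, hsep, by simp⟩, ?_, ?_,
      H.phase.length_pos⟩, ?_, H.full, ?_, ⟨?_, ?_⟩, ?_, by simp [H.eq_append htop], ?_, ?_⟩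
    · simpa [CountMode.tape] using H.phase.input
    · simpa [CountMode.tape] using H.phase.head_input
    · simpa [CountMode.tape] using H.phase.counter
    · simpa [CountMode.tape] using H.phase.head_counter
    · simpa [CountMode.tape] using H.stack
    · simpa [CountMode.tape] using H.head_stack
    · simp [CountMode.tape, countWord_append]
    · simpa [countWord_append, Nat.add_comm] using hlen
    · simp [CountMode.tape]
    · simpa [CountMode.tape] using H.ne_endL
    · simpa [CountMode.tape] using H.ne_endR

/-- Depth-first traversal: an outer induction on the height of the tree, an inner one along the
right-hand side. Descending one level adds one frame and uses up one unit of height, so the sum in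
`hK` is preserved. -/
theorem Represents.yields {w u₀ v₀ r₀ : List IsingSymbol} (hB : 0 < B)
    (hw : w = u₀ ++ .sep :: r₀) (hu : .sep ∉ u₀) (hv : (countWord v₀).length ≤ w.length)
    {K : ℕ} {β : List (Symbol IsingSymbol g.NT)} {y : List IsingSymbol}
    (hy : Yields (g.DerivesWithin K) β y) (hβ : β ∈ g.frames) {x : List IsingSymbol}
    (hx : x ++ y <+: u₀ ++ .sep :: v₀) {fs : List g.Frame} (hK : fs.length + 1 + K ≤ B * w.length)
    {c : (g.toLBA B).Config} (H : Represents w x (⟨β, hβ⟩ :: fs) c) :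
    ∃ c', ReflTransGen BeforeCompare c c' ∧ Represents w (x ++ y) fs c' := by
  induction K using Nat.strong_induction_on generalizing β y x fs c with
  | _ K ihK =>
    induction hy generalizing x c with
    | nil => simpa using H.drop hB rfl
    | @terminal a β y hy ih =>
      have hβ' := mem_frames_of_suffix hβ (List.suffix_cons _ _)
      have hx' : x ++ [a] ++ y <+: u₀ ++ .sep :: v₀ := by simpa using hx
      obtain ⟨c₁, h1, H1⟩ := H.terminal (f' := ⟨β, hβ'⟩) hB hw hu hv rfl
        ((List.prefix_append _ _).trans hx')
      obtain ⟨c₂, h2, H2⟩ := ih hβ' hx' H1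
      exact ⟨c₂, h1.trans h2, by simpa using H2⟩
    | @nonterminal A β y z hA hy ih =>
      obtain _ | K := K
      · exact hA.elim
      obtain ⟨r, hr, rfl, hry⟩ := hA
      have hβ' := mem_frames_of_suffix hβ (List.suffix_cons _ _)
      have hr' : r.output ∈ g.frames := Or.inr ⟨r, hr, List.suffix_rfl⟩
      have hx' : x ++ y ++ z <+: u₀ ++ .sep :: v₀ := by simpa using hx
      obtain ⟨c₁, h1, H1⟩ := H.expand (f' := ⟨β, hβ'⟩) (fr := ⟨r.output, hr'⟩) hB hr rfl rfl
        (by simp; omega)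
      obtain ⟨c₂, h2, H2⟩ := ihK K (Nat.lt_succ_self K) hry hr' ((List.prefix_append _ _).trans hx')
        (by simp; omega) H1
      obtain ⟨c₃, h3, H3⟩ := ih hβ' hx' H2
      exact ⟨c₃, (h1.trans h2).trans h3, by simpa using H3⟩

/-- Without frames, fullness of the blocks leaves no block on the tape, so one move to the left
meets the endmarker. The derived word contains the separator, hence the flag is set. -/
theorem Represents.exists_compare {w u v : List IsingSymbol} {c : (g.toLBA B).Config}
    (hB : 0 < B) (H : Represents w (u ++ .sep :: v) [] c) :
    ∃ t h, ReflTransGen BeforeCompare c ⟨.compare, t, h⟩ := by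
  obtain ⟨e, u', v', top, L, t, h, hx, rfl, H⟩ := H
  obtain rfl : e = true := by
    cases e with
    | true => rfl
    | false =>
      obtain ⟨-, -, -, hv⟩ := H.phase.word
      have := H.phase.sep_notMem
      rw [hv rfl] at hx
      simp only [derivedWord, Bool.false_eq_true, if_false, List.append_nil] at hx
      exact absurd (by simp [← hx]) this
  have hlen := H.length_eq
  have htop : top.1 = [] := List.eq_nil_of_length_eq_zero (by simp at hlen; omega)
  have hL : L = [] := by
    have : B * L.length = 0 := by rw [List.length_nil] at hlen; omega
    rcases Nat.mul_eq_zero.1 this with h0 | h0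
    · omega
    · exact List.eq_nil_of_length_eq_zero h0
  subst hL
  have h1 : t .stack (h .stack) ≠ .endL := by rw [H.head_stack]; exact H.ne_endL _
  refine ⟨_, _, .head ⟨by simp, toLBA_step_move (.pop _ true top htop)
    (fun h' => absurd h' h1) (by simp)⟩ (.single ⟨by simp, toLBA_step_stay (.done _ ?_)⟩)⟩
  simp only [Function.update_self, H.head_stack, HeadMove.apply, List.length_nil]
  exact H.stack

theorem represents_start {w : List IsingSymbol} (hB : 0 < B) (hw : w ≠ []) :
    ∃ c, ReflTransGen BeforeCompare ((g.toLBA B).init w) c ∧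
      Represents w [] [⟨[.nonterminal g.initial], Or.inl List.suffix_rfl⟩] c := by
  have hN : 0 < w.length := List.length_pos_iff.2 hw
  have hbit := (g.toLBA B).update_tapeOf_append (N := w.length) [] (TapeSymbol.bit false) hN
  have hblank : ∀ i, i ≠ LBATape.input →
      ((g.toLBA B).init w).tape i (((g.toLBA B).init w).head i) = .blank := by
    intro i hi
    simp [LinearBoundedAutomaton.init, hi, LinearBoundedAutomaton.tapeOf, hN]
  have hin : ((g.toLBA B).init w).tape .input (((g.toLBA B).init w).head .input) ≠ .endR ∧
      ((g.toLBA B).init w).tape .input (((g.toLBA B).init w).head .input) ≠ .endL := by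
    obtain ⟨a, w', rfl⟩ := List.exists_cons_of_ne_nil hw
    have := input_symbol (g := g) (B := B) (u := []) (x := a) (r := w')
    have h2 : ((g.toLBA B).init (a :: w')).tape .input
        (((g.toLBA B).init (a :: w')).head .input) = .letter a := by
      simpa [LinearBoundedAutomaton.init] using this
    rw [h2]; simp
  have hs := toLBA_step (t := ((g.toLBA B).init w).tape) (h := ((g.toLBA B).init w).head)
    (.start _ ⟨[⟨[.nonterminal g.initial], Or.inl List.suffix_rfl⟩], hB⟩ rfl
      (hblank _ (by simp)) (hblank _ (by simp)))
    (fun i hi => by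
      rcases eq_or_ne i .input with rfl | h
      · exact absurd hi hin.2
      · rw [hblank i h] at hi; cases hi)
    (fun i hi => by
      rcases eq_or_ne i .input with rfl | h
      · exact absurd hi hin.1
      · rw [hblank i h] at hi; cases hi)
  -- The soundness invariant already describes the configuration after the first step; only the
  -- content of the stack tape has to be added.
  have hI := DerivationInvariant.step (w := w) (q := .start) (by simp) ⟨rfl, rfl⟩ hs
  obtain ⟨u, v, L, H, -, -, -, hE, hhE⟩ := hI
  have hu : u = [] := by
    have := H.head_input
    simpa [LinearBoundedAutomaton.init, noMove, HeadMove.apply] using this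
  obtain ⟨-, -, -, hv⟩ := H.word
  obtain rfl := hv rfl
  subst hu
  have hst : (fun i => update (((g.toLBA B).init w).tape i) (((g.toLBA B).init w).head i)
      (update (update (fun i => ((g.toLBA B).init w).tape i (((g.toLBA B).init w).head i))
        LBATape.energy (TapeSymbol.bit false)) LBATape.counter (TapeSymbol.bit false) i)) .stack =
      (g.toLBA B).tapeOf w.length [] := by
    simp [LinearBoundedAutomaton.init]
  beta_reduce at hst
  refine ⟨_, .single ⟨by simp [LinearBoundedAutomaton.init], hs⟩, false, [], [], _, [], _, _, rfl,
    rfl, H, ?_, by simp, ?_, hE, hhE, by simp, fun i => ?_, fun i hi => ?_⟩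
  · rw [hst]; rfl
  · simp [LinearBoundedAutomaton.init, noMove, HeadMove.apply]
  · rw [hst]; exact LinearBoundedAutomaton.tapeOf_ne_endL _ (by simp)
  · rw [hst]; exact LinearBoundedAutomaton.tapeOf_ne_endR _ (by simp) (by omega)

/-- If the grammar derives a word `u • v` by a derivation tree of small height, then the automaton
reaches a comparison state on all inputs with prefix `u •`. -/
theorem exists_compare_of_derivesWithin {w u v r : List IsingSymbol} (hB : 0 < B)
    (hw : w = u ++ .sep :: r) (hu : .sep ∉ u) (hv : (countWord v).length ≤ w.length)
    {K : ℕ} (hd : g.DerivesWithin K g.initial (u ++ .sep :: v)) (hK : 1 + K ≤ B * w.length) :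
    ∃ t h, ReflTransGen BeforeCompare ((g.toLBA B).init w) ⟨.compare, t, h⟩ := by
  obtain ⟨c, hc, H⟩ := represents_start (g := g) (w := w) hB (by simp [hw])
  have hy := Yields.nonterminal (R := g.DerivesWithin K) hd .nil
  rw [List.append_nil] at hy
  obtain ⟨c', hc', H'⟩ := Represents.yields hB hw hu hv hy _ (List.prefix_rfl) (by simpa using hK) H
  obtain ⟨t, h, ht⟩ := H'.exists_compare hB
  exact ⟨t, h, (hc.trans hc').trans ht⟩

end ContextFreeGrammar


namespace IsingModel

open Function (update)
open Relation (ReflTransGen)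
open ContextFreeGrammar (BeforeCompare derivationInvariant_of_reachable DerivationInvariant
  ComparisonInvariant LBAState acceptsFrom_compare)

/-! ### Ising models with a context-free language -/

variable (M : IsingModel)

/-- An edge is determined by its set of endpoints because its endpoints are ordered; the empty set
of vertices is not attained, which makes the bound strict. -/
theorem card_edges_lt_two_pow {n : ℕ} (hn : n ∈ M.sizes) : (M.edges n).card < 2 ^ n := by
  classical
  let toSet : Fin n × Fin n → Finset (Fin n) := fun e => {e.1, e.2}
  have hinj : Set.InjOn toSet (M.edges n) := by
    rintro ⟨a, b⟩ he ⟨a', b'⟩ he' h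
    have h1 : a < b := M.edges_lt n hn _ he
    have h2 : a' < b' := M.edges_lt n hn _ he'
    have ha : a ∈ toSet (a', b') := h ▸ by simp [toSet]
    have hb : b ∈ toSet (a', b') := h ▸ by simp [toSet]
    simp only [toSet, Finset.mem_insert, Finset.mem_singleton] at ha hb
    rcases ha with rfl | rfl <;> rcases hb with rfl | rfl
    · exact absurd h1 (lt_irrefl _)
    · rfl
    · exact absurd h1 (lt_asymm h2)
    · exact absurd h1 (lt_irrefl _)
  have hne : (∅ : Finset (Fin n)) ∉ (M.edges n).image toSet := by
    simp [toSet, Finset.insert_ne_empty]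
  have h := Finset.card_lt_univ_of_notMem hne
  rwa [Finset.card_image_of_injOn hinj, Fintype.card_finset, Fintype.card_fin] at h

theorem natAbs_hamiltonian_le {n : ℕ} (s : Fin n → Bool) :
    (M.hamiltonian s).natAbs ≤ (M.edges n).card := by
  have h : |M.hamiltonian s| ≤ ∑ e ∈ M.edges n, 1 :=
    (Finset.abs_sum_le_sum_abs _ _).trans (Finset.sum_le_sum fun e _ => by split <;> simp)
  simp only [Finset.sum_const, nsmul_eq_mul, mul_one, Int.abs_eq_natAbs] at h
  exact_mod_cast h

/-- One sign bit and `n` digits take no more space than the spins and the separator, so the encoding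
fits whatever the input energy is. -/
theorem length_binary_hamiltonian_le {n : ℕ} (hn : n ∈ M.sizes) (s : Fin n → Bool) :
    (binary (M.hamiltonian s)).length ≤ n + 1 := by
  rw [binary, List.length_cons, Nat.size_eq_bits_len, Nat.add_le_add_iff_right, Nat.size_le]
  exact (M.natAbs_hamiltonian_le s).trans_lt (M.card_edges_lt_two_pow hn)

variable {M} {g : ContextFreeGrammar IsingSymbol} {B : ℕ}

/-- What the automaton has computed when it reaches its comparison state. -/
theorem compare_of_reachable (hg : g.language = M.language) {w : List IsingSymbol}
    {t : ContextFreeGrammar.LBATape → ℕ → g.TapeSymbol B} {h : ContextFreeGrammar.LBATape → ℕ}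
    (hc : ReflTransGen BeforeCompare ((g.toLBA B).init w) ⟨.compare, t, h⟩) :
    ∃ n ∈ M.sizes, ∃ s : Fin n → Bool, ∃ r,
      w = List.ofFn (fun i => spinSymbol (s i)) ++ .sep :: r ∧
      (binary (M.hamiltonian s)).length ≤ w.length ∧
      t .energy = (g.toLBA B).tapeOf w.length ((binary (M.hamiltonian s)).map .bit) ∧
      t .input = (g.toLBA B).tapeOf w.length (w.map .letter) ∧
      ∀ (z : ℤ) (T : ℕ → g.TapeSymbol B),
        ComparisonInvariant w (List.ofFn (fun i => spinSymbol (s i))) r z .compare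
          (update t .energy T) h := by
  obtain ⟨u, v, H, hmem, hE, hhE⟩ := derivationInvariant_of_reachable hc
  rw [hg] at hmem
  obtain ⟨n, hn, s, hs⟩ := hmem
  obtain ⟨rfl, rfl⟩ := append_sep_inj H.sep_notMem (sep_notMem_spins s) hs
  obtain ⟨rest, hw, hr, -⟩ := H.word
  obtain ⟨r, rfl⟩ := hr rfl
  have hE' := hE
  unfold ContextFreeGrammar.EnergyTape at hE'
  rw [countWord_energyWord] at hE'
  refine ⟨n, hn, s, r, hw, hE'.2, hE'.1, H.input, fun z T => ⟨H.head_input, hhE, ⟨?_, ?_⟩,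
    H.head_counter⟩⟩
  · rw [Function.update_of_ne (by simp), countWord_nil]; exact H.counter
  · rw [countWord_nil]; exact H.length_pos

/-- The tree is pruned with respect to the spins and the separator, so its height depends on `n`
alone, not on the length of the energy. That the pruned tree still derives the same word uses that
the language is the graph of a function. -/
theorem exists_compare (hg : g.language = M.language) {n : ℕ} (hn : n ∈ M.sizes)
    (s : Fin n → Bool) {w r : List IsingSymbol}
    (hw : w = List.ofFn (fun i => spinSymbol (s i)) ++ .sep :: r)
    (hB : 2 * g.rules.card + 1 ≤ B) :
    ∃ t h, ReflTransGen BeforeCompare ((g.toLBA B).init w) ⟨.compare, t, h⟩ := by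
  set u := List.ofFn (fun i => spinSymbol (s i)) with hu
  have hlen : n + 1 ≤ w.length := by rw [hw]; simp [hu]
  have hmem : u ++ .sep :: energyWord (M.hamiltonian s) ∈ g.language := by
    rw [hg]; exact M.spinEnergyWord_mem_language.2 ⟨hn, rfl⟩
  let p : IsingSymbol → Bool := fun a => decide (a ≠ .plus ∧ a ≠ .minus)
  have hpe : ∀ z, (energyWord z).filter p = [] := by
    intro z
    rw [List.filter_eq_nil_iff]
    intro a ha
    rcases mem_energyWord ha with rfl | rfl <;> simp [p]
  have hpu : ∀ {m : ℕ} (t : Fin m → Bool), (List.ofFn (fun i => spinSymbol (t i))).filter p =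
      List.ofFn (fun i => spinSymbol (t i)) := by
    intro m t
    rw [List.filter_eq_self]
    intro a ha
    obtain ⟨i, rfl⟩ := List.mem_ofFn.1 ha
    cases t i <;> simp [spinSymbol, p]
  have hp : ∀ {m : ℕ} (t : Fin m → Bool) (z : ℤ), (spinEnergyWord t z).filter p =
      List.ofFn (fun i => spinSymbol (t i)) ++ [.sep] := by
    intro m t z
    rw [spinEnergyWord, List.filter_append, List.filter_cons, hpe, hpu]
    simp [p]
  obtain ⟨K, hK⟩ := ContextFreeGrammar.Generates.exists_derivesWithin hmem
  obtain ⟨w', hw', hd⟩ := hK.exists_filter_eq p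
  have hmem' : w' ∈ M.language := by rw [← hg]; exact hd.derives
  have hlen' : ((u ++ .sep :: energyWord (M.hamiltonian s)).filter p).length = n + 1 := by
    have := hp s (M.hamiltonian s)
    rw [spinEnergyWord] at this
    rw [this]; simp
  rw [hlen'] at hd
  obtain ⟨m, hm, t, rfl⟩ := hmem'
  rw [hp, show u ++ .sep :: energyWord (M.hamiltonian s) = spinEnergyWord s (M.hamiltonian s)
    from rfl, hp] at hw'
  -- The pruned word is in the language with the same spins, so it also has the same energy part.
  obtain ⟨rfl, rfl⟩ := ofFn_spinSymbol_inj (List.append_cancel_right hw')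
  refine ContextFreeGrammar.exists_compare_of_derivesWithin (v := energyWord (M.hamiltonian s))
    (by omega) hw (sep_notMem_spins s) ?_ hd ?_
  · rw [countWord_energyWord]
    exact (M.length_binary_hamiltonian_le hn s).trans hlen
  -- With `R` rules and `m` spins the height is at most `R * (m + 2)`, and one frame is present at
  -- the start; `(2 * R + 1) * (m + 1)` exceeds their sum even for `m = 0`, or equals it.
  · have h1 : (2 * g.rules.card + 1) * (m + 1) ≤ B * w.length := Nat.mul_le_mul hB hlen
    nlinarith

theorem reachable_split {c d : (g.toLBA B).Config} (h : ReflTransGen (g.toLBA B).Step c d) :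
    ReflTransGen BeforeCompare c d ∨ ∃ t k, ReflTransGen BeforeCompare c ⟨.compare, t, k⟩ ∧
      ReflTransGen (g.toLBA B).Step ⟨.compare, t, k⟩ d := by
  induction h with
  | refl => exact Or.inl .refl
  | @tail c' d' _ hs ih =>
    rcases ih with ih | ⟨t, k, h1, h2⟩
    · by_cases hc : c'.state = .compare
      · obtain ⟨q, t, k⟩ := c'
        obtain rfl : q = .compare := hc
        exact Or.inr ⟨t, k, ih, .single hs⟩
      · exact Or.inl (ih.tail ⟨hc, hs⟩)
    · exact Or.inr ⟨t, k, h1, h2.tail hs⟩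

theorem not_accepting_of_beforeCompare {w : List IsingSymbol} {c : (g.toLBA B).Config}
    (hc : ReflTransGen BeforeCompare ((g.toLBA B).init w) c) : ¬ (g.toLBA B).Accepting c := by
  obtain ⟨q, t, h⟩ := c
  rintro ⟨ha, -⟩
  obtain rfl : q = .final := ha
  exact derivationInvariant_of_reachable hc

theorem toLBA_language (hg : g.language = M.language) (hB : 2 * g.rules.card + 1 ≤ B) :
    (g.toLBA B).language = M.language := by
  ext w
  constructor
  · rintro ⟨d, hd, ha⟩
    rcases reachable_split hd with h | ⟨t, k, h1, h2⟩
    · exact absurd ha (not_accepting_of_beforeCompare h)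
    · obtain ⟨n, hn, s, r, hw, hl, hE, hin, hI⟩ := compare_of_reachable hg h1
      have hI := hI (M.hamiltonian s) (t .energy)
      rw [Function.update_eq_self] at hI
      -- Nothing was assumed about the input behind the separator; acceptance shows that it is the
      -- unary energy.
      have := (acceptsFrom_compare hw hl hin hE hI).1 ⟨d, h2, ha⟩
      subst this
      rw [hw]
      exact M.spinEnergyWord_mem_language.2 ⟨hn, rfl⟩
  · rintro ⟨n, hn, s, hw⟩
    obtain ⟨t, k, h1⟩ := exists_compare hg hn s hw hB
    obtain ⟨m, hm, s', r, hw', hl, hE, hin, hI⟩ := compare_of_reachable hg h1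
    have hI := hI (M.hamiltonian s') (t .energy)
    rw [Function.update_eq_self] at hI
    obtain ⟨h3, rfl⟩ := append_sep_inj (sep_notMem_spins _) (sep_notMem_spins _) (hw.symm.trans hw')
    obtain ⟨rfl, rfl⟩ := ofFn_spinSymbol_inj h3
    exact ContextFreeGrammar.toLBA_acceptsFrom_of_reachable
      (ContextFreeGrammar.reachable_of_beforeCompare h1)
      ((acceptsFrom_compare hw' hl hin hE hI).2 rfl)

/-- Before it reaches its comparison state, the automaton does not read the input energy. -/
theorem head_input_le {n : ℕ} (s : Fin n → Bool) {w r : List IsingSymbol}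
    (hw : w = List.ofFn (fun i => spinSymbol (s i)) ++ .sep :: r) {c : (g.toLBA B).Config}
    (hc : ReflTransGen BeforeCompare ((g.toLBA B).init w) c) : c.head .input ≤ n + 1 := by
  have hphase : ∀ {u v : List IsingSymbol} {e : Bool},
      ContextFreeGrammar.DerivationPhase w u v e c.tape c.head → c.head .input ≤ n + 1 := by
    intro u v e H
    obtain ⟨rest, hrest, -, -⟩ := H.word
    rw [H.head_input]
    -- If the head were beyond the separator, the matched prefix `u` would contain it.
    by_contra hlt
    have hlen : (List.ofFn (fun i => spinSymbol (s i)) ++ [IsingSymbol.sep]).length ≤ u.length := by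
      simp; omega
    have hpre : List.ofFn (fun i => spinSymbol (s i)) ++ [.sep] <+: u :=
      List.prefix_of_prefix_length_le (l₃ := w) ⟨r, by simp [hw]⟩ ⟨rest, hrest.symm⟩ hlen
    exact H.sep_notMem (hpre.subset (by simp))
  have hI := derivationInvariant_of_reachable hc
  obtain ⟨q, t, h⟩ := c
  rcases q with _ | _ | _ | (_ | _) | (_ | _) | _ | _ | _ | _
  · rw [hI.2]; exact Nat.le_add_left 1 n
  · obtain ⟨u, v, L, H, -⟩ := hI; exact hphase H
  · obtain ⟨u, v, L, H, -⟩ := hI; exact hphase H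
  · obtain ⟨u, v, x, L, H, -⟩ := hI; exact hphase H
  · exact hI.elim
  · obtain ⟨u, v, L, H, -⟩ := hI; exact hphase H
  · exact hI.elim
  · obtain ⟨u, v, H, -⟩ := hI; exact hphase H
  all_goals exact hI.elim

theorem toLBA_isConstructiveFor (hg : g.language = M.language) (hB : 2 * g.rules.card + 1 ≤ B) :
    (g.toLBA B).IsConstructiveFor M := by
  classical
  refine ⟨toLBA_language hg hB, .energy, .bit, {.compare}, by simp,
    ContextFreeGrammar.bit_injective, by simp, fun n hn s k => ⟨fun c hc _ =>
    ⟨head_input_le s rfl hc, not_accepting_of_beforeCompare hc⟩, ?_, ?_⟩⟩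
  · obtain ⟨t, h, hc⟩ := exists_compare hg hn s (w := spinEnergyWord s k) rfl hB
    exact ⟨_, hc, rfl⟩
  · rintro ⟨q, t, h⟩ hc hq
    obtain rfl : q = .compare := hq
    obtain ⟨m, hm, s', r, hw, hl, hE, hin, hI⟩ := compare_of_reachable hg hc
    obtain ⟨h3, rfl⟩ := append_sep_inj (sep_notMem_spins _) (sep_notMem_spins _) hw
    obtain ⟨rfl, rfl⟩ := ofFn_spinSymbol_inj h3
    refine ⟨hl, hE, fun z hz => ?_⟩
    -- The invariant at the start of the comparison does not involve the content of the energy tape,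
    -- so it survives the replacement.
    have h4 := acceptsFrom_compare (t := update t .energy
      ((g.toLBA B).tapeOf (spinEnergyWord (s' ∘ Fin.cast rfl) k).length
        ((binary z).map .bit))) hw hz
      (by simpa using hin) (by simp) (hI z _)
    have h5 : energyWord k = energyWord z ↔ z = k :=
      ⟨fun h => (energyWord_inj h).symm, fun h => by rw [h]⟩
    convert h4.trans h5

theorem constructiveContextSensitive_of_isContextFree (h : M.language.IsContextFree) :
    M.ConstructiveContextSensitive := by
  obtain ⟨g, hg⟩ := h
  exact ⟨g.toLBA (2 * g.rules.card + 1), toLBA_isConstructiveFor hg le_rfl⟩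

end IsingModel

theorem mainTheorem4 (M : IsingModel) :
    (M.language.IsRegular → M.ConstructiveContextFree) ∧
    (M.language.IsContextFree → M.ConstructiveContextSensitive) :=
  ⟨M.constructiveContextFree_of_isRegular, IsingModel.constructiveContextSensitive_of_isContextFree⟩
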